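/- Let $P$ be a simple polygon in the plane with $n\ge 3$ vertices (collinear vertices are allowed), regarded as the closed set consisting of its boundary together with the points enclosed by it. Two points of $P$ see each other if the closed line segment between them lies in $P$ (it may run partly or wholly along the boundary). The visibility graph $G(P)$ has the vertices of $P$ as its vertices and an edge between any two distinct vertices that see each other. For a vertex $v$ of a finite graph $G$ let $N[v]$ be the set consisting of $v$ and its neighbours; $v$ dominates $u$ if $N[u]\subseteq N[v]$. In the cops and robbers game on $G$ the cop first chooses a starting vertex, then the robber chooses one; after that they move alternately, the cop first, each with full information about the positions. A move goes along an edge or stays in place. The robber is caught when the cop moves to the vertex that the robber is on. $G$ is cop-win if the cop has a strategy that always catches the robber. $G$ is $2$-dismantlable (Bonato et al.) if either it has fewer than $7$ vertices and is cop-win, or it has two distinct vertices $a,b$, each dominated by some vertex other than $a$ and $b$, such that $G-\{a,b\}$ is $2$-dismantlable. **Theorem.** The visibility graph of every simple polygon is $2$-dismantlable. Moreover, on the visibility graph of a simple polygon with $n$ vertices, the cop, by a suitable choice of starting vertex and strategy, catches the robber after at most $n/2$ cop moves, whatever the robber does. -/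

import Mathlib

namespace Polygon

/-- A polygon in the plane is simple if it has at least three vertices and its boundary, traversed
once edge by edge, never visits a point twice (each edge is taken here without its final endpoint).
Three or more vertices are allowed to be collinear. -/
structure IsSimple {n : ℕ} (P : Polygon (EuclideanSpace ℝ (Fin 2)) n) : Prop where
  three_le : 3 ≤ n
  boundary_injective : ∀ i j : Fin n, ∀ s ∈ Set.Ico (0 : ℝ) 1, ∀ t ∈ Set.Ico (0 : ℝ) 1,
    P.edgePath ℝ i s = P.edgePath ℝ j t → i = j ∧ s = t

/-- The points enclosed by the boundary: those off the boundary whose connected component in the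
complement of the boundary is bounded. -/
def enclosed {n : ℕ} (P : Polygon (EuclideanSpace ℝ (Fin 2)) n) :
    Set (EuclideanSpace ℝ (Fin 2)) :=
  {x | x ∉ P.boundary ℝ ∧ Bornology.IsBounded (connectedComponentIn (P.boundary ℝ)ᶜ x)}

/-- The polygon as a closed set of points: the interior together with the boundary. -/
def region {n : ℕ} (P : Polygon (EuclideanSpace ℝ (Fin 2)) n) :
    Set (EuclideanSpace ℝ (Fin 2)) :=
  P.boundary ℝ ∪ P.enclosed

/-- Two points see each other in the polygon if the closed segment joining them lies in it;
the segment may touch the boundary or run along it. -/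
def Sees {n : ℕ} (P : Polygon (EuclideanSpace ℝ (Fin 2)) n)
    (x y : EuclideanSpace ℝ (Fin 2)) : Prop :=
  segment ℝ x y ⊆ P.region

/-- The visibility graph: one vertex for each vertex of the polygon, and an edge between any two
different vertices that see each other. -/
def visibilityGraph {n : ℕ} (P : Polygon (EuclideanSpace ℝ (Fin 2)) n) :
    SimpleGraph (Fin n) where
  Adj i j := i ≠ j ∧ P.Sees (P i) (P j)
  symm := ⟨fun i j h => ⟨h.1.symm, by
    have h2 := h.2
    unfold Sees at h2 ⊢
    rwa [segment_symm]⟩⟩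
  loopless := ⟨fun _ h => h.1 rfl⟩

end Polygon

namespace SimpleGraph

universe u

/-- The closed neighbourhood `N[v]`. -/
def closedNeighborSet {V : Type u} (G : SimpleGraph V) (v : V) : Set V :=
  insert v (G.neighborSet v)

/-- `v` dominates `w` if `N[w] ⊆ N[v]`. -/
def Dominates {V : Type u} (G : SimpleGraph V) (v w : V) : Prop :=
  G.closedNeighborSet w ⊆ G.closedNeighborSet v

/-- A strategy of the cop: a starting vertex, and a rule that gives, from the current positions of
the cop and the robber, the vertex to which the cop moves. A move goes along an edge, or stays. -/
structure CopStrategy {V : Type u} (G : SimpleGraph V) where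
  start : V
  move : V → V → V
  move_mem : ∀ c r, move c r ∈ G.closedNeighborSet c

/-- A play of the robber: a starting vertex `r 0` and successive moves, each along an edge or
staying in place. -/
def IsRobberPlay {V : Type u} (G : SimpleGraph V) (r : ℕ → V) : Prop :=
  ∀ k, r (k + 1) ∈ G.closedNeighborSet (r k)

/-- The position of the cop after `k` moves against the play `r`. The cop moves first, so the
cop's move number `k + 1` is made when the robber is on `r k`. -/
def CopStrategy.position {V : Type u} {G : SimpleGraph V} (σ : G.CopStrategy) (r : ℕ → V) : ℕ → V
  | 0 => σ.start
  | k + 1 => σ.move (σ.position r k) (r k)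

/-- Against the play `r`, the cop's move number `k` brings the cop to the vertex on which
the robber is. -/
def CopStrategy.CatchesAt {V : Type u} {G : SimpleGraph V} (σ : G.CopStrategy) (r : ℕ → V)
    (k : ℕ) : Prop :=
  1 ≤ k ∧ σ.position r k = r (k - 1)

/-- The cop has a strategy that catches the robber, whatever the robber does. -/
def CopWin {V : Type u} (G : SimpleGraph V) : Prop :=
  ∃ σ : G.CopStrategy, ∀ r : ℕ → V, G.IsRobberPlay r → ∃ k, σ.CatchesAt r k

/-- The cop has a strategy that catches the robber in at most `m` cop moves, whatever
the robber does. -/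
def CopWinsWithin {V : Type u} (G : SimpleGraph V) (m : ℕ) : Prop :=
  ∃ σ : G.CopStrategy, ∀ r : ℕ → V, G.IsRobberPlay r → ∃ k ≤ m, σ.CatchesAt r k

/-- A finite graph is 2-dismantlable if it has fewer than seven vertices and is cop-win, or has two
different vertices `a`, `b`, each dominated by a vertex other than `a` and `b`, such that deleting
`a` and `b` leaves a 2-dismantlable graph. -/
inductive IsTwoDismantlable : {V : Type u} → SimpleGraph V → Prop
  | small {V : Type u} [Finite V] (G : SimpleGraph V) (hcard : Nat.card V < 7)
      (hwin : G.CopWin) : IsTwoDismantlable G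
  | step {V : Type u} [Finite V] (G : SimpleGraph V) (a b : V) (hab : a ≠ b)
      (ha : ∃ v, v ≠ a ∧ v ≠ b ∧ G.Dominates v a)
      (hb : ∃ v, v ≠ a ∧ v ≠ b ∧ G.Dominates v b)
      (hrest : IsTwoDismantlable (G.induce {v : V | v ≠ a ∧ v ≠ b})) : IsTwoDismantlable G

end SimpleGraph

/-!
The plane is identified with `ℂ`. The idea is to find, in the visibility graph of a polygon, two
vertices that are dominated by others, to remove them, and to repeat this. As the polygon spanned by
the remaining vertices may degenerate, the region `K` is kept, and vertices are removed only from
the set `V` of points on which the game is played. What survives is recorded in `Scene`: `K` is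
compact without holes, `V` is connected by visibility, and if the line of sight from `p` to a point
moving along a visible segment `[q, x]` gets stuck, then it gets stuck at a point of `V` other than
`p`. `Scene.exists_tangent` turns this into a tangent point `s`: a point of `V` on the last free
line of sight, with points off `K` arbitrarily close to `s` in a corner between `p` and another
point of `V` (`Blocked`).

Existence of a dominated point (`Scene.exists_dominated`). Unless `r` sees everything, some tangent
point `s` from `r` has points of `V` behind the obstacle at `s`. If `s` sees whatever any of these
points sees, then `s` dominates all of them; if not, there is a tangent point from `s`, and the
pursuit goes on (`Scene.exists_next`). The trail of the pursuit never meets itself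
(`Trail.not_mem_of_node`): the first meeting would close a simple polygon in `K` that has a point
off `K` inside it, near a vertex that is extreme in some direction (`false_of_closed_trail`). Such a
point could be joined to infinity by a line that meets the polygon just once. That this is
impossible is the part of the Jordan curve theorem needed here; it is obtained from continuous
branches of `log (z - o)` on `K`, which exist for all `o` off `K` because `K` has no holes
(`not_joinedIn_of_crossing`). As `V` is finite, the pursuit ends, and the last point dominates all
points behind its obstacle. One of these is moreover `Exposed`: all that it sees is strictly on one
side of a line through it.

Removal (`Scene.remove`). No line of sight gets stuck at a dominated exposed point `g`: the
triangles that `g` forms with the dominating point and the points that it sees lie in `K` and leave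
no room for an obstacle. Hence a scene remains, and two dominated points with dominating points
different from both exist as soon as `V` has three points (`Scene.exists_two_dominated`).

The game (`copWinsWithin_succ_of_dominates`). The cop plays on the smaller graph against the shadow
of the robber, in which `a` and `b` are replaced by the vertices that dominate them, and needs one
more move after catching the shadow. So every pair of vertices costs one move.

Finally, the vertices of a simple polygon form a scene (`SimplePath.scene`): near a point inside an
edge, the outside consists of half-discs along the edge, so that a line of sight can only get stuck
at a vertex (`SimplePath.tangent`).
-/

namespace PolygonVisibility

open Complex Set Topology

/-! ### Cross products and plane sets without holes -/

/-- The cross product (oriented area) of two plane vectors. -/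
def cr (z w : ℂ) : ℝ := z.re * w.im - z.im * w.re

lemma cr_self (z : ℂ) : cr z z = 0 := by simp only [cr]; ring

lemma cr_swap (z w : ℂ) : cr w z = -cr z w := by simp only [cr]; ring

lemma cr_add_left (x y z : ℂ) : cr (x + y) z = cr x z + cr y z := by
  simp only [cr, add_re, add_im]; ring

lemma cr_add_right (x y z : ℂ) : cr z (x + y) = cr z x + cr z y := by
  simp only [cr, add_re, add_im]; ring

lemma cr_mul_left (t : ℝ) (x y : ℂ) : cr (t * x) y = t * cr x y := by
  simp only [cr, re_ofReal_mul, im_ofReal_mul]; ring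

lemma cr_mul_right (t : ℝ) (x y : ℂ) : cr x (t * y) = t * cr x y := by
  simp only [cr, re_ofReal_mul, im_ofReal_mul]; ring

lemma cr_neg_left (x y : ℂ) : cr (-x) y = -cr x y := by
  simp only [cr, neg_re, neg_im]; ring

lemma cr_neg_right (x y : ℂ) : cr x (-y) = -cr x y := by
  simp only [cr, neg_re, neg_im]; ring

lemma exists_real_mul_of_cr_eq_zero {z w : ℂ} (hz : z ≠ 0) (h : cr z w = 0) :
    ∃ t : ℝ, w = t * z := by
  obtain ⟨n, hn⟩ : ∃ n, n = z.re * z.re + z.im * z.im := ⟨_, rfl⟩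
  have hn0 : n ≠ 0 := fun h => hz (normSq_eq_zero.1 (by rw [normSq_apply, ← hn, h]))
  refine ⟨(w.re * z.re + w.im * z.im) / n, ?_⟩
  simp only [cr] at h
  apply Complex.ext
  · rw [re_ofReal_mul]
    field_simp
    linear_combination w.re * hn - z.im * h
  · rw [im_ofReal_mul]
    field_simp
    linear_combination w.im * hn + z.re * h

/-- Cramer's rule: two vectors with nonzero cross product span the plane. -/
lemma exists_coords {z w : ℂ} (h : cr z w ≠ 0) (x : ℂ) : ∃ s t : ℝ, x = s * z + t * w := by
  refine ⟨cr x w / cr z w, cr z x / cr z w, ?_⟩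
  apply Complex.ext
  · simp only [add_re, re_ofReal_mul]
    field_simp
    simp only [cr]; ring
  · simp only [add_im, im_ofReal_mul]
    field_simp
    simp only [cr]; ring

/-- A plane set without holes: no component of its complement is bounded. -/
def HoleFree (K : Set ℂ) : Prop :=
  ∀ o ∉ K, ¬ Bornology.IsBounded (connectedComponentIn Kᶜ o)

/-- A continuous branch of `log (x - o)` on `K` yields one of `log (x - o')` for each `o'` closer to
`o` than `K` is. -/
lemma exists_log_of_near {K : Set ℂ} {o o' : ℂ} (h : ∀ x ∈ K, ‖o - o'‖ < ‖x - o‖)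
    (hL : ∃ L : ℂ → ℂ, ContinuousOn L K ∧ ∀ x ∈ K, exp (L x) = x - o) :
    ∃ L : ℂ → ℂ, ContinuousOn L K ∧ ∀ x ∈ K, exp (L x) = x - o' := by
  obtain ⟨L, hc, he⟩ := hL
  have h0 : ∀ x ∈ K, x - o ≠ 0 := fun x hx => by
    have := (norm_nonneg _).trans_lt (h x hx)
    exact norm_pos_iff.1 this
  have hs : ∀ x ∈ K, 1 + (o - o') / (x - o) ∈ slitPlane := fun x hx => by
    apply mem_slitPlane_of_norm_lt_one
    rw [norm_div, div_lt_one (norm_pos_iff.2 (h0 x hx))]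
    exact h x hx
  refine ⟨fun x => L x + log (1 + (o - o') / (x - o)), ?_, fun x hx => ?_⟩
  · refine hc.add (ContinuousOn.clog ?_ hs)
    exact continuousOn_const.add (continuousOn_const.div (by fun_prop) h0)
  · rw [exp_add, he x hx, exp_log (slitPlane_ne_zero (hs x hx))]
    have := h0 x hx
    field_simp
    ring

/-- Eilenberg's criterion: if the compact set `K` has no holes, then `x - o` has a continuous
logarithm on `K` for each point `o` off `K`, because `o` can be moved to infinity off `K`. -/
lemma exists_log {K : Set ℂ} (hK : IsCompact K) (hH : HoleFree K) {o : ℂ} (ho : o ∉ K) :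
    ∃ L : ℂ → ℂ, ContinuousOn L K ∧ ∀ x ∈ K, exp (L x) = x - o := by
  by_contra hno
  let good : ℂ → Prop := fun o => ∃ L : ℂ → ℂ, ContinuousOn L K ∧ ∀ x ∈ K, exp (L x) = x - o
  have hloc : ∀ a ∉ K, ∃ δ > 0, ∀ b, dist b a < δ → b ∉ K ∧ (good a ↔ good b) := by
    intro a ha
    obtain ⟨δ, hδ, hball⟩ := Metric.isOpen_iff.1 hK.isClosed.isOpen_compl a ha
    have hd : ∀ x ∈ K, δ ≤ ‖x - a‖ := fun x hx => by
      by_contra! hlt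
      exact hball (by simpa [dist_eq_norm] using hlt) hx
    refine ⟨δ / 2, by positivity, fun b hb => ⟨hball (Metric.mem_ball.2 (by linarith)), ?_, ?_⟩⟩
    · refine exists_log_of_near fun x hx => ?_
      rw [← dist_eq_norm, dist_comm]
      linarith [hd x hx]
    · refine exists_log_of_near fun x hx => ?_
      have h1 := hd x hx
      have h2 : ‖x - a‖ ≤ ‖x - b‖ + ‖b - a‖ := by simpa using norm_add_le (x - b) (b - a)
      rw [dist_eq_norm] at hb
      linarith
  obtain ⟨R, hR⟩ := hK.isBounded.exists_norm_le
  -- far away the logarithm exists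
  have hfar : ∀ a : ℂ, R < ‖a‖ → good a := by
    intro a ha
    by_cases hKe : K = ∅
    · exact ⟨0, by simp [hKe], by simp [hKe]⟩
    obtain ⟨x0, hx0⟩ := nonempty_iff_ne_empty.2 hKe
    have ha0 : a ≠ 0 := norm_pos_iff.1 (((norm_nonneg x0).trans (hR x0 hx0)).trans_lt ha)
    have hs : ∀ x ∈ K, 1 + (-x / a) ∈ slitPlane := fun x hx => by
      apply mem_slitPlane_of_norm_lt_one
      rw [norm_div, div_lt_one (norm_pos_iff.2 ha0), norm_neg]
      exact (hR x hx).trans_lt ha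
    refine ⟨fun x => log (-a) + log (1 + (-x / a)), ?_, fun x hx => ?_⟩
    · exact continuousOn_const.add (ContinuousOn.clog (by fun_prop) hs)
    · rw [exp_add, exp_log (neg_ne_zero.2 ha0), exp_log (slitPlane_ne_zero (hs x hx))]
      field_simp
      ring
  have hC := isPreconnected_connectedComponentIn (x := o) (F := Kᶜ)
  have hsub := connectedComponentIn_subset Kᶜ o
  have hu : ∀ p : ℂ → Prop, (∀ a b, (good a ↔ good b) → p a → p b) →
      IsOpen {a | a ∉ K ∧ p a} := by
    intro p hp
    rw [Metric.isOpen_iff]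
    rintro a ⟨ha, hga⟩
    obtain ⟨δ, hδ, h⟩ := hloc a ha
    exact ⟨δ, hδ, fun b hb => ⟨(h b hb).1, hp a b (h b hb).2 hga⟩⟩
  have hfarpt : ∃ a ∈ connectedComponentIn Kᶜ o, R < ‖a‖ := by
    by_contra! hall
    exact hH o ho (isBounded_iff_forall_norm_le.2 ⟨R, hall⟩)
  obtain ⟨a, haC, haR⟩ := hfarpt
  obtain ⟨b, -, hb1, hb2⟩ := hC _ _ (hu good fun a b h => h.1) (hu (fun a => ¬ good a)
    fun a b h h1 h2 => h1 (h.2 h2)) (fun b hb => by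
      by_cases hg : good b
      · exact Or.inl ⟨hsub hb, hg⟩
      · exact Or.inr ⟨hsub hb, hg⟩) ⟨a, haC, hsub haC, hfar a haR⟩
    ⟨o, mem_connectedComponentIn ho, ho, hno⟩
  exact hb2.2 hb1.2

/-- A continuous function whose exponential is constantly `1` is constant on connected sets. -/
lemma eq_of_exp_eq_one {D : ℂ → ℂ} {C : Set ℂ} (hC : IsPreconnected C) (hD : ContinuousOn D C)
    (h1 : ∀ x ∈ C, exp (D x) = 1) {a b : ℂ} (ha : a ∈ C) (hb : b ∈ C) : D a = D b := by
  by_contra hne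
  have him : ∀ x ∈ C, ∃ k : ℤ, (D x).re = 0 ∧ (D x).im = k * (2 * Real.pi) := by
    intro x hx
    obtain ⟨k, hk⟩ := exp_eq_one_iff.1 (h1 x hx)
    exact ⟨k, by simp [hk], by simp [hk]⟩
  have hI2 := hC.image (fun x => (D x).im / (2 * Real.pi))
    ((continuous_im.comp_continuousOn hD).div_const _)
  have hT : (fun x => (D x).im / (2 * Real.pi)) '' C ⊆ range ((↑) : ℤ → ℝ) := by
    rintro _ ⟨x, hx, rfl⟩
    obtain ⟨k, -, hk⟩ := him x hx
    exact ⟨k, by simp only [hk]; field_simp⟩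
  have hsub := Int.isClosedEmbedding_coe_real.isEmbedding.isTotallyDisconnected_range.2
    inferInstance _ hT hI2
  have heq := hsub (mem_image_of_mem _ ha) (mem_image_of_mem _ hb)
  obtain ⟨_, ha0, -⟩ := him a ha
  obtain ⟨_, hb0, -⟩ := him b hb
  apply hne
  apply Complex.ext
  · rw [ha0, hb0]
  · have hpi : (2 * Real.pi) ≠ 0 := by positivity
    field_simp at heq
    exact heq

/-- A segment of `K` that crosses a segment joining two points `o`, `o'` off `K` separates the two
sides of the crossing: the difference of the two logarithms of `x - o` and `x - o'` is continuous
on `K`, whereas the principal value of `log ((x - o) / (x - o'))` jumps across `[o, o']` only. -/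
lemma not_joinedIn_of_crossing {K : Set ℂ} (hK : IsCompact K) (hH : HoleFree K) {o o' a w : ℂ}
    (ho : o ∉ K) (ho' : o' ∉ K) (haw : segment ℝ a w ⊆ K)
    (hopp : cr (o' - o) (a - o) * cr (o' - o) (w - o) < 0)
    (hm : ∀ z ∈ segment ℝ a w, cr (o' - o) (z - o) = 0 → z ∈ segment ℝ o o') :
    ¬ JoinedIn (K \ segment ℝ o o') a w := by
  intro hJ
  obtain ⟨L, hLc, hLe⟩ := exists_log hK hH ho
  obtain ⟨L', hLc', hLe'⟩ := exists_log hK hH ho'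
  have hz : ∀ z ∈ K, z - o ≠ 0 ∧ z - o' ≠ 0 := fun z hz =>
    ⟨sub_ne_zero.2 fun h => ho (h ▸ hz), sub_ne_zero.2 fun h => ho' (h ▸ hz)⟩
  let Q : ℂ → ℂ := fun z => (z - o) / (z - o')
  have hQc : ContinuousOn Q K :=
    ContinuousOn.div (by fun_prop) (by fun_prop) fun z hz' => (hz z hz').2
  have hQe : ∀ z ∈ K, exp (L z - L' z) = Q z := fun z hz' => by
    rw [exp_sub, hLe z hz', hLe' z hz']
  have hQ0 : ∀ z ∈ K, Q z ≠ 0 := fun z hz' => div_ne_zero (hz z hz').1 (hz z hz').2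
  -- off `[o, o']` the quotient avoids the negative real axis
  have hs1 : ∀ z ∈ K \ segment ℝ o o', Q z ∈ slitPlane := by
    rintro z ⟨hzK, hzs⟩
    by_contra hn
    rw [mem_slitPlane_iff] at hn
    push Not at hn
    apply hzs
    obtain ⟨hre, him⟩ := hn
    have hQr : Q z = ((Q z).re : ℂ) := Complex.ext (by simp) (by simp [him])
    have h1 : z - o = ((Q z).re : ℂ) * (z - o') := by
      rw [← hQr]; exact (div_mul_cancel₀ _ (hz z hzK).2).symm
    set ρ := (Q z).re
    have h1ρ : (0 : ℝ) < 1 - ρ := by linarith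
    refine ⟨1 / (1 - ρ), -ρ / (1 - ρ), by positivity, div_nonneg (by linarith) h1ρ.le, ?_, ?_⟩
    · field_simp; ring
    · have h2 : ((1 : ℂ) - ρ) ≠ 0 := by exact_mod_cast h1ρ.ne'
      simp only [real_smul]
      push_cast
      field_simp
      linear_combination -h1
  -- along `[a, w]` it avoids the positive real axis
  have hs2 : ∀ z ∈ segment ℝ a w, -Q z ∈ slitPlane := by
    intro z hzs
    have hzK := haw hzs
    by_contra hn
    rw [mem_slitPlane_iff] at hn
    push Not at hn
    obtain ⟨hre, him⟩ := hn
    simp only [neg_re, neg_im, neg_nonpos, neg_eq_zero] at hre him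
    have hQr : Q z = ((Q z).re : ℂ) := Complex.ext (by simp) (by simp [him])
    have h1 : z - o = ((Q z).re : ℂ) * (z - o') := by
      rw [← hQr]; exact (div_mul_cancel₀ _ (hz z hzK).2).symm
    set ρ := (Q z).re
    have h1re := congrArg re h1
    have h1im := congrArg im h1
    simp only [sub_re, sub_im, re_ofReal_mul, im_ofReal_mul] at h1re h1im
    obtain ⟨s, t, hs, ht, hst, hzt⟩ := hm z hzs (by
      simp only [cr, sub_re, sub_im]
      have : (o'.re - o.re) * (z.im - o.im) - (o'.im - o.im) * (z.re - o.re)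
        = (o'.re - z.re) * (z.im - o.im) - (o'.im - z.im) * (z.re - o.re) := by ring
      rw [this, h1re, h1im]; ring)
    obtain rfl : s = 1 - t := by linarith
    have hzt' : z - o = t * (o' - o) := by
      rw [← hzt]; simp only [real_smul]; push_cast; ring
    have hoo : o' - o ≠ 0 := fun h => (hz z hzK).1 (by rw [hzt', h, mul_zero])
    have h3 : (t : ℂ) = ρ * (t - 1) := by
      apply mul_right_cancel₀ hoo
      rw [← hzt', h1]
      linear_combination (ρ : ℂ) * hzt'
    have h4 : t = ρ * (t - 1) := by exact_mod_cast h3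
    have h5 : t = 0 := by nlinarith
    apply (hz z hzK).1
    rw [hzt', h5]; simp
  have haS := left_mem_segment ℝ a w
  have hwS := right_mem_segment ℝ a w
  have hE : L a - L' a - log (-Q a) + Real.pi * I = L w - L' w - log (-Q w) + Real.pi * I :=
    eq_of_exp_eq_one (D := fun z => L z - L' z - log (-Q z) + Real.pi * I)
      (convex_segment a w).isPreconnected
      ((((hLc.mono haw).sub (hLc'.mono haw)).sub ((hQc.mono haw).neg.clog hs2)).add
        continuousOn_const) (fun z hzs => by
          have := hQ0 z (haw hzs)
          rw [exp_add, exp_sub, hQe z (haw hzs), exp_log (neg_ne_zero.2 this), exp_pi_mul_I]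
          field_simp) haS hwS
  have hD : L a - L' a - log (Q a) = L w - L' w - log (Q w) := by
    obtain ⟨γ, hγ⟩ := hJ
    have hsub : range γ ⊆ K \ segment ℝ o o' := by rintro _ ⟨t, rfl⟩; exact hγ t
    have hsubK := hsub.trans sdiff_subset
    exact eq_of_exp_eq_one (D := fun z => L z - L' z - log (Q z))
      (isPreconnected_range γ.continuous)
      (((hLc.mono hsubK).sub (hLc'.mono hsubK)).sub
        ((hQc.mono hsubK).clog fun z hz' => hs1 z (hsub hz'))) (fun z hzs => by
          have := hQ0 z (hsubK hzs)
          rw [exp_sub, hQe z (hsubK hzs), exp_log this, div_self this])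
      ⟨0, γ.source⟩ ⟨1, γ.target⟩
  have hlog : log (-Q a) - log (Q a) = log (-Q w) - log (Q w) := by linear_combination hD - hE
  have hargs : arg (-Q a) - arg (Q a) = arg (-Q w) - arg (Q w) := by
    have := congrArg im hlog
    simpa [log_im] using this
  have him : ∀ z ∈ K, (Q z).im * normSq (z - o') = -cr (o' - o) (z - o) := fun z hz' => by
    have hn : normSq (z - o') ≠ 0 := fun h => (hz z hz').2 (normSq_eq_zero.1 h)
    simp only [Q, div_im, cr, sub_re, sub_im]
    field_simp
    ring
  have hpos : ∀ z ∈ K, 0 < normSq (z - o') := fun z hz' => normSq_pos.2 (hz z hz').2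
  have h1 := him a (haw haS)
  have h2 := him w (haw hwS)
  have p1 := hpos a (haw haS)
  have p2 := hpos w (haw hwS)
  have hpi := Real.pi_pos
  rcases mul_neg_iff.1 hopp with ⟨hp, hn⟩ | ⟨hn, hp⟩
  · have i1 : (Q a).im < 0 := by
      by_contra! h; nlinarith [mul_nonneg h p1.le]
    have i2 : 0 < (Q w).im := by
      by_contra! h; nlinarith [mul_nonneg (neg_nonneg.2 h) p2.le]
    rw [arg_neg_eq_arg_add_pi_of_im_neg i1, arg_neg_eq_arg_sub_pi_of_im_pos i2] at hargs
    linarith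
  · have i1 : 0 < (Q a).im := by
      by_contra! h; nlinarith [mul_nonneg (neg_nonneg.2 h) p1.le]
    have i2 : (Q w).im < 0 := by
      by_contra! h; nlinarith [mul_nonneg h p2.le]
    rw [arg_neg_eq_arg_sub_pi_of_im_pos i1, arg_neg_eq_arg_add_pi_of_im_neg i2] at hargs
    linarith

/-- A triangle with its three sides in a set without holes lies in it. -/
lemma HoleFree.triangle_subset {K : Set ℂ} (hH : HoleFree K) {a b c : ℂ}
    (hab : segment ℝ a b ⊆ K) (hbc : segment ℝ b c ⊆ K) (hac : segment ℝ a c ⊆ K) {r s t : ℝ}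
    (hr : 0 ≤ r) (hs : 0 ≤ s) (ht : 0 ≤ t) (hrst : r + s + t = 1) : r * a + s * b + t * c ∈ K := by
  have key : ∀ {x y : ℂ} {p q : ℝ}, segment ℝ x y ⊆ K → 0 ≤ p → 0 ≤ q → p + q = 1 →
      (p : ℂ) * x + q * y ∈ K := fun h hp hq hpq => h ⟨_, _, hp, hq, hpq, by simp⟩
  by_contra hz
  set z := (r : ℂ) * a + s * b + t * c with hzdef
  set Δ := cr (b - a) (c - a) with hΔ
  by_cases h0 : Δ = 0
  · -- three collinear points
    by_cases hba : b = a
    · apply hz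
      have := key hac (p := r + s) (q := t) (by positivity) ht hrst
      convert this using 1
      rw [hzdef, hba]; push_cast; ring
    · obtain ⟨τ, hτ'⟩ := exists_real_mul_of_cr_eq_zero (sub_ne_zero.2 hba) h0
      have hτ : c = a + τ * (b - a) := by linear_combination hτ'
      apply hz
      rcases lt_or_ge (s + t * τ) 0 with hneg | hnn
      · have hτ0 : τ < 0 := by by_contra! h; nlinarith [mul_nonneg ht h]
        have h1 : 0 ≤ (s + t * τ) / τ := div_nonneg_of_nonpos hneg.le hτ0.le
        have h2 : (s + t * τ) / τ ≤ 1 := by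
          rw [div_le_one_of_neg hτ0]; nlinarith
        have := key hac (p := 1 - (s + t * τ) / τ) (q := (s + t * τ) / τ) (by linarith) h1 (by ring)
        convert this using 1
        obtain rfl : r = 1 - s - t := by linarith
        have : (τ : ℂ) ≠ 0 := by exact_mod_cast hτ0.ne
        rw [hzdef, hτ]; push_cast; field_simp; ring
      rcases le_or_gt (s + t * τ) 1 with hle | hgt
      · have := key hab (p := 1 - (s + t * τ)) (q := s + t * τ) (by linarith) hnn (by ring)
        convert this using 1
        obtain rfl : r = 1 - s - t := by linarith
        rw [hzdef, hτ]; push_cast; ring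
      · have hτ1 : 0 < τ - 1 := by by_contra! h; nlinarith
        have h1 : 0 ≤ (s + t * τ - 1) / (τ - 1) := div_nonneg (by linarith) hτ1.le
        have h2 : (s + t * τ - 1) / (τ - 1) ≤ 1 := by
          rw [div_le_one hτ1]; nlinarith
        have := key hbc (p := 1 - (s + t * τ - 1) / (τ - 1)) (q := (s + t * τ - 1) / (τ - 1))
          (by linarith) h1 (by ring)
        convert this using 1
        obtain rfl : r = 1 - s - t := by linarith
        have : ((τ : ℂ) - 1) ≠ 0 := by exact_mod_cast hτ1.ne'
        rw [hzdef, hτ]; push_cast; field_simp; ring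
  · -- barycentric coordinates
    let f : ℂ → ℝ := fun w => cr (b - w) (c - w) / Δ
    let g : ℂ → ℝ := fun w => cr (c - w) (a - w) / Δ
    let h : ℂ → ℝ := fun w => cr (a - w) (b - w) / Δ
    have hfc : Continuous f := by simp only [f, cr]; fun_prop
    have hgc : Continuous g := by simp only [g, cr]; fun_prop
    have hhc : Continuous h := by simp only [h, cr]; fun_prop
    have hsum : ∀ w, f w + g w + h w = 1 := fun w => by
      simp only [f, g, h]
      rw [← add_div, ← add_div, div_eq_one_iff_eq h0]
      simp only [hΔ, cr, sub_re, sub_im]; ring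
    have hrep : ∀ w, w = f w * a + g w * b + h w * c := fun w => by
      have hC : Δ ≠ 0 := h0
      apply Complex.ext
      · simp only [f, g, h, add_re, re_ofReal_mul]
        field_simp
        simp only [hΔ, cr, sub_re, sub_im]; ring
      · simp only [f, g, h, add_im, im_ofReal_mul]
        field_simp
        simp only [hΔ, cr, sub_re, sub_im]; ring
    have hside : ∀ w ∉ K, 0 ≤ f w → 0 ≤ g w → 0 ≤ h w → 0 < f w ∧ 0 < g w ∧ 0 < h w := by
      intro w hw h1 h2 h3
      have hs := hsum w
      have hr := hrep w
      refine ⟨h1.lt_of_ne fun e => hw ?_, h2.lt_of_ne fun e => hw ?_, h3.lt_of_ne fun e => hw ?_⟩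
      · rw [hr, ← e]
        simpa using key hbc h2 h3 (by linarith)
      · rw [hr, ← e]
        simpa using key hac h1 h3 (by linarith)
      · rw [hr, ← e]
        simpa using key hab h1 h2 (by linarith)
    have hC := isPreconnected_connectedComponentIn (x := z) (F := Kᶜ)
    have hsub := connectedComponentIn_subset Kᶜ z
    have hu : IsOpen {w | 0 < f w ∧ 0 < g w ∧ 0 < h w} :=
      (isOpen_lt continuous_const hfc).inter
        ((isOpen_lt continuous_const hgc).inter (isOpen_lt continuous_const hhc))
    have hv : IsOpen {w | f w < 0 ∨ g w < 0 ∨ h w < 0} :=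
      (isOpen_lt hfc continuous_const).union
        ((isOpen_lt hgc continuous_const).union (isOpen_lt hhc continuous_const))
    have hzu : 0 < f z ∧ 0 < g z ∧ 0 < h z := by
      have e1 : f z = r := by
        simp only [f]
        rw [div_eq_iff h0, hzdef]
        obtain rfl : r = 1 - s - t := by linarith
        simp only [hΔ, cr, sub_re, sub_im, add_re, add_im, re_ofReal_mul, im_ofReal_mul]; ring
      have e2 : g z = s := by
        simp only [g]
        rw [div_eq_iff h0, hzdef]
        obtain rfl : r = 1 - s - t := by linarith
        simp only [hΔ, cr, sub_re, sub_im, add_re, add_im, re_ofReal_mul, im_ofReal_mul]; ring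
      have e3 : h z = t := by have := hsum z; linarith
      exact hside z hz (e1 ▸ hr) (e2 ▸ hs) (e3 ▸ ht)
    have hcov : connectedComponentIn Kᶜ z ⊆ {w | 0 < f w ∧ 0 < g w ∧ 0 < h w} ∪
        {w | f w < 0 ∨ g w < 0 ∨ h w < 0} := by
      intro w hw
      by_cases hneg : f w < 0 ∨ g w < 0 ∨ h w < 0
      · exact Or.inr hneg
      · push Not at hneg
        exact Or.inl (hside w (hsub hw) hneg.1 hneg.2.1 hneg.2.2)
    by_cases hne : (connectedComponentIn Kᶜ z ∩ {w | f w < 0 ∨ g w < 0 ∨ h w < 0}).Nonempty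
    · obtain ⟨w, -, ⟨h1, h2, h3⟩, h4⟩ := hC _ _ hu hv hcov
        ⟨z, mem_connectedComponentIn hz, hzu⟩ hne
      rcases h4 with h4 | h4 | h4 <;> linarith
    · apply hH z hz
      refine isBounded_iff_forall_norm_le.2 ⟨‖a‖ + ‖b‖ + ‖c‖, fun w hw => ?_⟩
      have hwu : 0 < f w ∧ 0 < g w ∧ 0 < h w := (hcov hw).resolve_right fun h => hne ⟨w, hw, h⟩
      have hs := hsum w
      have bound : ∀ (p : ℝ) (x : ℂ), 0 ≤ p → p ≤ 1 → ‖(p : ℂ) * x‖ ≤ ‖x‖ := fun p x h1 h2 => by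
        rw [norm_mul, norm_real, Real.norm_of_nonneg h1]
        exact mul_le_of_le_one_left (norm_nonneg _) h2
      calc ‖w‖ = ‖(f w : ℂ) * a + g w * b + h w * c‖ := by rw [← hrep]
        _ ≤ _ := norm_add₃_le
        _ ≤ _ := add_le_add (add_le_add (bound _ _ hwu.1.le (by linarith))
            (bound _ _ hwu.2.1.le (by linarith))) (bound _ _ hwu.2.2.le (by linarith))

/-! ### Blocked corners -/

/-- The corner at `c` between the directions of `a` and `v` is blocked if points off `K` accumulate
at `c` within the cone spanned by these directions. -/
def Blocked (K : Set ℂ) (c a v : ℂ) : Prop :=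
  ∀ ε > 0, ∃ α β : ℝ, 0 ≤ α ∧ α < ε ∧ 0 ≤ β ∧ β < ε ∧ c + α * (a - c) + β * (v - c) ∉ K

/-- A blocked corner remains blocked if small vectors of its cone that lead to points off `K` are
small vectors of the new cone. -/
lemma Blocked.change {K : Set ℂ} {c a v a' v' : ℂ} (h : Blocked K c a v) {C δ : ℝ} (hC : 0 < C)
    (hδ : 0 < δ)
    (H : ∀ α β : ℝ, 0 ≤ α → α < δ → 0 ≤ β → β < δ → c + α * (a - c) + β * (v - c) ∉ K →
      ∃ α' β' : ℝ, 0 ≤ α' ∧ α' ≤ C * (α + β) ∧ 0 ≤ β' ∧ β' ≤ C * (α + β) ∧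
        c + α * (a - c) + β * (v - c) = c + α' * (a' - c) + β' * (v' - c)) :
    Blocked K c a' v' := by
  intro ε hε
  obtain ⟨α, β, h1, h2, h3, h4, h5⟩ := h (min δ (ε / (2 * C))) (by positivity)
  rw [lt_min_iff] at h2 h4
  obtain ⟨α', β', g1, g2, g3, g4, g5⟩ := H α β h1 h2.1 h3 h4.1 h5
  have h6 : C * (α + β) < ε := by
    have e1 := h2.2
    have e2 := h4.2
    rw [lt_div_iff₀ (by positivity)] at e1 e2
    linarith
  exact ⟨α', β', g1, by linarith, g3, by linarith, by rwa [← g5]⟩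

lemma Blocked.rescale {K : Set ℂ} {c a v a' v' : ℂ} (h : Blocked K c a v) {s t : ℝ} (hs : 0 < s)
    (ht : 0 < t) (ha : a - c = s * (a' - c)) (hv : v - c = t * (v' - c)) : Blocked K c a' v' := by
  refine h.change (C := s + t) (δ := 1) (by positivity) one_pos fun α β h1 _ h2 _ _ =>
    ⟨α * s, β * t, by positivity, ?_, by positivity, ?_, ?_⟩
  · nlinarith [mul_nonneg h1 ht.le, mul_nonneg h2 hs.le, mul_nonneg h2 ht.le]
  · nlinarith [mul_nonneg h1 ht.le, mul_nonneg h1 hs.le, mul_nonneg h2 hs.le]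
  · rw [ha, hv]; push_cast; ring

/-- A corner spanned within a triangle of `K` is not blocked, so a direction `s` seen together with
`g` cannot enclose the blocked corner `(a, g)`. -/
lemma Blocked.false_of_triangle {K : Set ℂ} {c a g s : ℂ} (h : Blocked K c a g)
    (htri : ∀ p q : ℝ, 0 ≤ p → 0 ≤ q → p + q ≤ 1 → c + p * (g - c) + q * (s - c) ∈ K) {ξ η : ℝ}
    (hs : s - c = ξ * (a - c) + η * (g - c)) (hξ : 0 < ξ) (hη : η ≤ 0) : False := by
  obtain ⟨α, β, h1, h2, h3, h4, h5⟩ := h (min (1 / 2) (ξ / (2 * (1 - η))))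
    (lt_min (by norm_num) (div_pos hξ (by linarith)))
  rw [lt_min_iff] at h2 h4
  have h6 : α * (2 * (1 - η)) < ξ := (lt_div_iff₀ (by linarith)).1 h2.2
  have h7 : (1 - η) * α / ξ ≤ 1 / 2 := by rw [div_le_iff₀ hξ]; linarith
  have hξ' : (ξ : ℂ) ≠ 0 := by exact_mod_cast hξ.ne'
  apply h5
  have := htri (β + α * -η / ξ) (α / ξ)
    (add_nonneg h3 (div_nonneg (mul_nonneg h1 (by linarith)) hξ.le)) (by positivity) (by
      have : β + α * -η / ξ + α / ξ = β + (1 - η) * α / ξ := by ring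
      rw [this]; linarith [h4.1])
  convert this using 1
  have e : a - c = (s - c - η * (g - c)) / ξ := by rw [hs]; field_simp; ring
  rw [e]; push_cast; field_simp; ring

/-- If `c`, `g`, `s` span a triangle of `K`, then a corner blocked between `a` and `g` is also
blocked between `a` and `s`, provided that `s` is on the same side as `g`. -/
lemma Blocked.transfer {K : Set ℂ} {c a g s : ℂ} (h : Blocked K c a g)
    (htri : ∀ p q : ℝ, 0 ≤ p → 0 ≤ q → p + q ≤ 1 → c + p * (g - c) + q * (s - c) ∈ K) {ξ η : ℝ}
    (hs : s - c = ξ * (a - c) + η * (g - c)) (hη : 0 < η) : Blocked K c a s := by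
  have hη' : (η : ℂ) ≠ 0 := by exact_mod_cast hη.ne'
  refine h.change (C := 1 + |ξ| / η + 1 / η) (δ := η / (η + 1)) (by positivity) (by positivity)
    fun α β h1 h2 h3 h4 h5 => ?_
  rcases le_or_gt (β * ξ) (α * η) with hle | hlt
  · refine ⟨α - β * ξ / η, β / η, ?_, ?_, by positivity, ?_, ?_⟩
    · rw [sub_nonneg, div_le_iff₀ hη]; exact hle
    · have e1 : -(β * ξ / η) ≤ |ξ| / η * β := by
        have := neg_abs_le ξ
        rw [← neg_div, div_mul_eq_mul_div]
        gcongr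
        nlinarith
      have e2 : 0 ≤ |ξ| / η * α := by positivity
      have e3 : 0 ≤ 1 / η * (α + β) := by positivity
      linarith
    · have e2 : 0 ≤ |ξ| / η * (α + β) := by positivity
      have e3 : 0 ≤ 1 / η * α := by positivity
      have e4 : β / η = 1 / η * β := by ring
      linarith
    · rw [hs]; push_cast; field_simp; ring
  · have hξ : 0 < ξ := by
      by_contra! hn
      nlinarith [mul_nonneg h1 hη.le, mul_nonneg h3 (neg_nonneg.2 hn)]
    have hξ' : (ξ : ℂ) ≠ 0 := by exact_mod_cast hξ.ne'
    exfalso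
    apply h5
    have e1 : α / ξ ≤ β / η := by rw [div_le_div_iff₀ hξ hη]; exact hlt.le
    have e2 : β * (η + 1) < η := (lt_div_iff₀ (by positivity)).1 h4
    have e3 : 0 ≤ α * η / ξ := by positivity
    have e4 : β + β / η ≤ 1 := by
      have : β + β / η = β * (η + 1) / η := by field_simp
      rw [this, div_le_one hη]; exact e2.le
    have := htri (β - α * η / ξ) (α / ξ) (by rw [sub_nonneg, div_le_iff₀ hξ]; exact hlt.le)
      (by positivity) (by linarith)
    convert this using 1
    have e : a - c = (s - c - η * (g - c)) / ξ := by rw [hs]; field_simp; ring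
    rw [e]; push_cast; field_simp; ring

/-! ### Exposed points and points inside a closed polygon -/

/-- Among the points of a finite set beyond a line, one is the only maximum of some linear
functional: take a point farthest from a centre that is remote on the other side of the line. -/
lemma exists_exposed (S : Finset ℂ) (e : ℂ) (θ : ℝ) (h : ∃ z ∈ S, θ < cr e z) :
    ∃ w ∈ S, θ < cr e w ∧ ∃ l : ℂ, ∀ z ∈ S, z ≠ w → cr l z < cr l w := by
  obtain ⟨z1, hz1, hpos⟩ := h
  obtain ⟨x0, hx0, hN⟩ := S.exists_max_image normSq ⟨z1, hz1⟩
  have hd : 0 < cr e z1 - θ := by linarith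
  obtain ⟨T, hT⟩ : ∃ T, T = (normSq x0 + 1) / (cr e z1 - θ) := ⟨_, rfl⟩
  have hTp : 0 < T := by rw [hT]; have := normSq_nonneg x0; positivity
  have hT2 : T * (cr e z1 - θ) = normSq x0 + 1 := by rw [hT]; field_simp
  obtain ⟨w, hw, hmax⟩ := S.exists_max_image (fun z => normSq z + 2 * (T * (cr e z - θ))) ⟨z1, hz1⟩
  refine ⟨w, hw, ?_, (T * e.re + w.im : ℝ) + (T * e.im - w.re : ℝ) * I, fun z hz hne => ?_⟩
  · by_contra! hle
    have h1 := hmax z1 hz1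
    have h2 := hN w hw
    have h3 : T * (cr e w - θ) ≤ 0 := mul_nonpos_of_nonneg_of_nonpos hTp.le (by linarith)
    rw [hT2] at h1
    have := normSq_nonneg z1
    have := normSq_nonneg x0
    linarith
  · have h1 := hmax z hz
    have h2 : 0 < normSq (z - w) := normSq_pos.2 (sub_ne_zero.2 hne)
    simp only [normSq_apply, cr, sub_re, sub_im, add_re, add_im, ofReal_re, ofReal_im, mul_re,
      mul_im, I_re, I_im] at h1 h2 ⊢
    nlinarith

/-- A closed polygon in `K` cannot have a point off `K` inside it, near a vertex `w` or along the
edge from `w` to `b`: this point could be joined to infinity by a line that crosses the polygon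
only once, in the other edge `[a, w]` at `w`. Here `R` is the rest of the polygon. -/
lemma false_of_line_meeting_once {K : Set ℂ} (hK : IsCompact K) (hH : HoleFree K) {a w b : ℂ}
    {R : Set ℂ} (hR : R ⊆ K) (haw : segment ℝ a w ⊆ K) (hJ : JoinedIn R a w)
    (hcr : cr (a - w) (b - w) ≠ 0) {α κ₀ : ℝ} (hα : 0 < α) (hα1 : α < 1) (hκ : 0 < κ₀)
    (ho : w + α * (a - w) + κ₀ * (b - w) ∉ K)
    (hmiss : ∀ κ ≤ κ₀, w + α * (a - w) + (κ : ℝ) * (b - w) ∉ R) : False := by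
  obtain ⟨N, hN⟩ := hK.isBounded.exists_norm_le
  have hbw : b - w ≠ 0 := fun h => hcr (by rw [h]; simp [cr])
  have hbw' : 0 < ‖b - w‖ := norm_pos_iff.2 hbw
  -- the other end of the line, far off
  obtain ⟨κ₁, hκ₁⟩ : ∃ κ₁, κ₁ = (|N| + ‖w + α * (a - w)‖ + 1) / ‖b - w‖ := ⟨_, rfl⟩
  have hκ₁p : 0 < κ₁ := by rw [hκ₁]; positivity
  have ho' : w + α * (a - w) + (-κ₁ : ℝ) * (b - w) ∉ K := fun hmem => by
    have h1 := hN _ hmem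
    have h2 : ‖((-κ₁ : ℝ) : ℂ) * (b - w)‖ = |N| + ‖w + α * (a - w)‖ + 1 := by
      rw [norm_mul, norm_real, Real.norm_eq_abs, abs_neg, abs_of_pos hκ₁p, hκ₁]
      field_simp
    have h3 : ‖((-κ₁ : ℝ) : ℂ) * (b - w)‖ ≤
        ‖w + α * (a - w) + (-κ₁ : ℝ) * (b - w)‖ + ‖w + α * (a - w)‖ := by
      have := norm_sub_le (w + α * (a - w) + (-κ₁ : ℝ) * (b - w)) (w + α * (a - w))
      rwa [add_sub_cancel_left] at this
    have := le_abs_self N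
    linarith
  set o := w + α * (a - w) + κ₀ * (b - w) with hodef
  set o' := w + α * (a - w) + (-κ₁ : ℝ) * (b - w) with hodef'
  have hd : o' - o = (-(κ₀ + κ₁) : ℝ) * (b - w) := by rw [hodef, hodef']; push_cast; ring
  have hcoord : ∀ x y : ℝ, cr (o' - o) (w + x * (a - w) + y * (b - w) - o) =
      (κ₀ + κ₁) * (x - α) * cr (a - w) (b - w) := fun x y => by
    have : w + x * (a - w) + y * (b - w) - o = (x - α : ℝ) * (a - w) + (y - κ₀ : ℝ) * (b - w) := by
      rw [hodef]; push_cast; ring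
    rw [this, hd, cr_mul_left, cr_add_right, cr_mul_right, cr_mul_right, cr_self,
      cr_swap (a - w)]
    ring
  have hseg : ∀ t : ℝ, 0 ≤ t → t ≤ 1 →
      w + α * (a - w) + ((1 - t) * κ₀ - t * κ₁ : ℝ) * (b - w) ∈ segment ℝ o o' := fun t h0 h1 => by
    refine ⟨1 - t, t, by linarith, h0, by ring, ?_⟩
    rw [hodef, hodef']; simp only [real_smul]; push_cast; ring
  refine not_joinedIn_of_crossing hK hH ho ho' haw ?_ ?_ (hJ.mono fun z hz => ⟨hR hz, ?_⟩)
  · have e1 : a = w + (1 : ℝ) * (a - w) + (0 : ℝ) * (b - w) := by push_cast; ring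
    have e2 : w = w + (0 : ℝ) * (a - w) + (0 : ℝ) * (b - w) := by push_cast; ring
    have h1 := hcoord 1 0
    have h2 := hcoord 0 0
    rw [← e1] at h1
    rw [← e2] at h2
    rw [h1, h2]
    have : 0 < cr (a - w) (b - w) * cr (a - w) (b - w) := mul_self_pos.2 hcr
    have h3 : (κ₀ + κ₁) * (1 - α) * cr (a - w) (b - w) * ((κ₀ + κ₁) * (0 - α) * cr (a - w) (b - w))
      = -((κ₀ + κ₁) * (κ₀ + κ₁) * ((1 - α) * α) * (cr (a - w) (b - w) * cr (a - w) (b - w))) := by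
      ring
    rw [h3, neg_lt_zero]
    have : 0 < 1 - α := by linarith
    positivity
  · rintro z ⟨s, t, hs, ht, hst, rfl⟩ hz
    have e : s • a + t • w = w + s * (a - w) + (0 : ℝ) * (b - w) := by
      obtain rfl : t = 1 - s := by linarith
      simp only [real_smul]; push_cast; ring
    rw [e, hcoord] at hz
    have hs' : s = α := by
      have h1 : κ₀ + κ₁ ≠ 0 := by positivity
      have := (mul_eq_zero.1 hz).resolve_right hcr
      have := (mul_eq_zero.1 this).resolve_left h1
      linarith
    rw [e, hs']
    have := hseg (κ₀ / (κ₀ + κ₁)) (by positivity) (by rw [div_le_one (by positivity)]; linarith)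
    convert this using 4
    field_simp; ring
  · rintro ⟨s, t, hs, ht, hst, rfl⟩
    refine hmiss (s * κ₀ - t * κ₁) (by nlinarith) ?_
    convert hz using 1
    obtain rfl : s = 1 - t := by linarith
    rw [hodef, hodef']; simp only [real_smul]; push_cast; ring

/-! ### Closed trails -/

/-- The situation at a vertex `c` of a polygonal trail arriving from `a` and leaving to `b`, with
points off `K` near `c` on the side of the line `ac` given by the sign of `ε`: either the trail
turns around the obstacle, or it continues beyond the direction opposite to the blocked corner. -/
def Node (K : Set ℂ) (a c b : ℂ) (ε : ℝ) : Prop :=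
  (Blocked K c a b ∧ 0 < ε * cr (c - a) (b - c)) ∨
    ∃ v, Blocked K c a v ∧ 0 < ε * cr (c - a) (v - c) ∧
      ∃ ξ η : ℝ, ξ < 0 ∧ η ≤ 0 ∧ b - c = ξ * (a - c) + η * (v - c)

lemma Node.rescale {K : Set ℂ} {a c b a' b' : ℂ} {ε : ℝ} (h : Node K a c b ε) {s t : ℝ} (hs : 0 < s)
    (ht : 0 < t) (ha : a' - c = s * (a - c)) (hb : b' - c = t * (b - c)) : Node K a' c b' ε := by
  have hs' : (s : ℂ) ≠ 0 := by exact_mod_cast hs.ne'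
  have ht' : (t : ℂ) ≠ 0 := by exact_mod_cast ht.ne'
  have ha1 : a - c = (s⁻¹ : ℝ) * (a' - c) := by rw [ha]; push_cast; field_simp
  have hb1 : b - c = (t⁻¹ : ℝ) * (b' - c) := by rw [hb]; push_cast; field_simp
  have ha2 : c - a' = s * (c - a) := by linear_combination -ha
  rcases h with ⟨h1, h2⟩ | ⟨v, h1, h2, ξ, η, hξ, hη, h3⟩
  · refine Or.inl ⟨h1.rescale (inv_pos.2 hs) (inv_pos.2 ht) ha1 hb1, ?_⟩
    rw [ha2, hb, cr_mul_left, cr_mul_right]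
    have : ε * (s * (t * cr (c - a) (b - c))) = s * t * (ε * cr (c - a) (b - c)) := by ring
    rw [this]; positivity
  · refine Or.inr ⟨v, h1.rescale (inv_pos.2 hs) one_pos ha1 (by simp), ?_, t * ξ / s, t * η,
      ?_, ?_, ?_⟩
    · rw [ha2, cr_mul_left]
      have : ε * (s * cr (c - a) (v - c)) = s * (ε * cr (c - a) (v - c)) := by ring
      rw [this]; positivity
    · exact div_neg_of_neg_of_pos (mul_neg_of_pos_of_neg ht hξ) hs
    · exact mul_nonpos_of_nonneg_of_nonpos ht.le hη
    · rw [hb, h3, ha]; push_cast; field_simp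

/-- A trail within `R` joins its vertices within `R`. -/
lemma joinedIn_chain {R : Set ℂ} (d : ℕ → ℂ) {p q : ℕ} (hpq : p ≤ q) (hp : d p ∈ R)
    (h : ∀ l, p ≤ l → l < q → segment ℝ (d l) (d (l + 1)) ⊆ R) : JoinedIn R (d p) (d q) := by
  induction q, hpq using Nat.le_induction with
  | base => exact JoinedIn.refl hp
  | succ q hq ih =>
    exact (ih fun l h1 h2 => h l h1 (by omega)).trans
      (JoinedIn.of_segment_subset (h q hq (by omega)))

lemma cr_le_of_mem_segment {l x y z : ℂ} {θ : ℝ} (hx : cr l x ≤ θ) (hy : cr l y ≤ θ)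
    (hz : z ∈ segment ℝ x y) : cr l z ≤ θ := by
  obtain ⟨s, t, hs, ht, hst, rfl⟩ := hz
  simp only [real_smul]
  rw [cr_add_right, cr_mul_right, cr_mul_right]
  have h1 := mul_le_mul_of_nonneg_left hx hs
  have h2 := mul_le_mul_of_nonneg_left hy ht
  have h3 : s * θ + t * θ = θ := by rw [← add_mul, hst, one_mul]
  linarith

lemma isCompact_segment (x y : ℂ) : IsCompact (segment ℝ x y) := by
  rw [segment_eq_image]
  exact isCompact_Icc.image (by fun_prop)

/-- A point off a segment is beyond a line that has the segment on its other side. -/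
lemma exists_separating {x y z : ℂ} (h : z ∉ segment ℝ x y) :
    ∃ e : ℂ, ∃ θ : ℝ, cr e x ≤ θ ∧ cr e y ≤ θ ∧ θ < cr e z := by
  obtain ⟨f, u, h1, h2⟩ := geometric_hahn_banach_closed_point (convex_segment x y)
    (isCompact_segment x y).isClosed h
  have hf : ∀ x : ℂ, cr ((f I : ℝ) + (-f 1 : ℝ) * I) x = f x := fun x => by
    conv_rhs => rw [← re_add_im x]
    have : (x.re : ℂ) + x.im * I = x.re • (1 : ℂ) + x.im • I := by simp
    rw [this, map_add, map_smul, map_smul]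
    simp only [cr, add_re, add_im, ofReal_re, ofReal_im, mul_re, mul_im, I_re, I_im, smul_eq_mul]
    ring
  refine ⟨(f I : ℝ) + (-f 1 : ℝ) * I, u, ?_, ?_, ?_⟩
  · rw [hf]; exact (h1 _ (left_mem_segment ℝ x y)).le
  · rw [hf]; exact (h1 _ (right_mem_segment ℝ x y)).le
  · rw [hf]; exact h2

/-- A closed polygon all of whose vertices but `d 0` carry obstacles as in `Node`, those on the two
ends of an edge being related as in `hlink`, cannot be simple. At an exposed vertex the obstacle, or
else that of the next vertex, would lie inside the polygon. -/
lemma false_of_closed_trail {K : Set ℂ} (hK : IsCompact K) (hH : HoleFree K) (d : ℕ → ℂ)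
    (ε : ℕ → ℝ) {m : ℕ} (hclosed : d (m + 1) = d 0)
    (hdK : ∀ l ≤ m, segment ℝ (d l) (d (l + 1)) ⊆ K)
    (hne : ∀ i j, i < j → j ≤ m → d i ≠ d j)
    (hdisj : ∀ i j, i + 1 < j → j ≤ m → ¬ (i = 0 ∧ j = m) →
      Disjoint (segment ℝ (d i) (d (i + 1))) (segment ℝ (d j) (d (j + 1))))
    (hm : 2 ≤ m) (h1 : d 1 ∉ segment ℝ (d m) (d (m + 1)))
    (hnode : ∀ j < m, Node K (d j) (d (j + 1)) (d (j + 2)) (ε (j + 1)))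
    (hlink : ∀ j, j + 1 < m → ε (j + 1) * cr (d (j + 1) - d j) (d (j + 2) - d (j + 1)) < 0 →
      0 < ε (j + 2) * cr (d (j + 1) - d j) (d (j + 2) - d (j + 1))) : False := by
  classical
  obtain ⟨e, θ, hem, he0, he1⟩ := exists_separating h1
  rw [hclosed] at he0
  obtain ⟨w, hwS, hwθ, u, hu⟩ := exists_exposed ((Finset.range (m + 1)).image d) e θ
    ⟨d 1, Finset.mem_image_of_mem _ (by simp; omega), he1⟩
  obtain ⟨j, hj, rfl⟩ := Finset.mem_image.1 hwS
  rw [Finset.mem_range] at hj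
  have hj0 : j ≠ 0 := by rintro rfl; linarith
  have hjm : j ≠ m := by rintro rfl; linarith
  obtain ⟨i, rfl⟩ := Nat.exists_eq_succ_of_ne_zero hj0
  simp only [Nat.succ_eq_add_one] at *
  have hneq : ∀ l ≤ m, l ≠ i + 1 → d l ≠ d (i + 1) := fun l hl hli => by
    rcases lt_or_gt_of_ne hli with h | h
    · exact hne _ _ h (by omega)
    · exact (hne _ _ h hl).symm
  have hu' : ∀ l ≤ m, l ≠ i + 1 → cr u (d l) < cr u (d (i + 1)) := fun l hl hli =>
    hu _ (Finset.mem_image_of_mem _ (by simp; omega)) (hneq l hl hli)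
  -- a common gap between the maximum and the values at the other vertices
  obtain ⟨η₀, hη₀, hgap⟩ : ∃ η₀ > 0, ∀ l ≤ m, l ≠ i + 1 → cr u (d l) ≤ cr u (d (i + 1)) - η₀ := by
    obtain ⟨k, hk, hmax⟩ := ((Finset.range (m + 1)).erase (i + 1)).exists_max_image
      (fun l => cr u (d l)) ⟨i, by simp; omega⟩
    simp only [Finset.mem_erase, Finset.mem_range] at hk hmax
    refine ⟨cr u (d (i + 1)) - cr u (d k), sub_pos.2 (hu' k (by omega) hk.1), fun l hl hli => ?_⟩
    have := hmax l ⟨hli, by omega⟩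
    linarith
  have hgap' : ∀ l ≤ m, l ≠ i → l ≠ i + 1 → ∀ z ∈ segment ℝ (d l) (d (l + 1)),
      cr u z ≤ cr u (d (i + 1)) - η₀ := fun l hl h1 h2 z hz => by
    refine cr_le_of_mem_segment (hgap l hl h2) ?_ hz
    rcases eq_or_lt_of_le hl with rfl | hlt
    · rw [hclosed]; exact hgap 0 (by omega) (by omega)
    · exact hgap (l + 1) (by omega) (by omega)
  set a := d i with ha
  set w := d (i + 1) with hw
  set b := d (i + 2) with hb
  have hA : 0 < cr u w - cr u a := sub_pos.2 (hu' i (by omega) (by omega))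
  have hB : 0 < cr u w - cr u b := sub_pos.2 (hu' (i + 2) (by omega) (by omega))
  have huz : ∀ x y : ℝ, cr u (w + x * (a - w) + y * (b - w)) =
      cr u w - x * (cr u w - cr u a) - y * (cr u w - cr u b) := fun x y => by
    rw [sub_eq_add_neg a, sub_eq_add_neg b]
    simp only [cr_add_right, cr_mul_right, cr_neg_right]; ring
  have hτ : cr (w - a) (b - w) ≠ 0 := by
    intro h0
    rcases hnode i (by omega) with ⟨-, h⟩ | ⟨v, -, hv, ξ, η, hξ, hη, h⟩
    · rw [← ha, ← hw, ← hb, h0] at h; simp at h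
    · rw [← ha, ← hw] at hv
      rw [← ha, ← hw, ← hb] at h
      have e1 : cr (w - a) (b - w) = η * cr (w - a) (v - w) := by
        rw [h, cr_add_right, cr_mul_right, cr_mul_right, ← neg_sub w a, cr_neg_right, cr_self]; ring
      have e2 : cr (w - a) (v - w) ≠ 0 := fun h => by rw [h] at hv; simp at hv
      have e3 : η = 0 := (mul_eq_zero.1 (e1.symm.trans h0)).resolve_right e2
      have e4 := huz ξ 0
      have e5 : w + ξ * (a - w) + (0 : ℝ) * (b - w) = b := by
        have : b = w + (b - w) := by ring
        rw [this, h, e3]; push_cast; ring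
      rw [e5] at e4
      nlinarith
  have hcr : cr (a - w) (b - w) ≠ 0 := by rwa [← neg_sub w a, cr_neg_left, neg_ne_zero]
  let R : Set ℂ := ⋃ l ∈ {l | l ≤ m ∧ l ≠ i}, segment ℝ (d l) (d (l + 1))
  have hRl : ∀ l ≤ m, l ≠ i → segment ℝ (d l) (d (l + 1)) ⊆ R := fun l hl hli =>
    subset_biUnion_of_mem (u := fun l => segment ℝ (d l) (d (l + 1)))
      (show l ≤ m ∧ l ≠ i from ⟨hl, hli⟩)
  have hRK : R ⊆ K := iUnion₂_subset fun l hl => hdK l hl.1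
  have hJ : JoinedIn R a w := by
    refine JoinedIn.symm (JoinedIn.trans (y := d 0) ?_ ?_)
    · rw [← hclosed]
      exact joinedIn_chain d (by omega) (hRl (i + 1) (by omega) (by omega) (left_mem_segment ℝ _ _))
        fun l h1 h2 => hRl l (by omega) (by omega)
    · refine joinedIn_chain d (by omega) ?_ fun l h1 h2 => hRl l (by omega) (by omega)
      rw [← hclosed]
      exact hRl m le_rfl (by omega) (right_mem_segment ℝ _ _)
  have hfin : ∀ α κ₀ : ℝ, 0 < α → α < 1 → 0 < κ₀ → w + α * (a - w) + κ₀ * (b - w) ∉ K →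
      (∀ κ ≤ κ₀, ∀ l ≤ m, l ≠ i → l ≠ i + 1 → w + α * (a - w) + (κ : ℝ) * (b - w) ∉
        segment ℝ (d l) (d (l + 1))) → False := by
    intro α κ₀ h1 h2 h3 h4 h5
    refine false_of_line_meeting_once hK hH hRK (hdK i (by omega)) hJ hcr h1 h2 h3 h4
      fun κ hκ hz => ?_
    obtain ⟨l, ⟨hl, hli⟩, hz⟩ := mem_iUnion₂.1 hz
    by_cases hl1 : l = i + 1
    · subst hl1
      obtain ⟨s, t, hs, ht, hst, hz⟩ := hz
      obtain rfl : s = 1 - t := by linarith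
      rw [← hw, ← hb] at hz
      have : α * cr (a - w) (b - w) = 0 := by
        rw [← cr_mul_left]
        have e : (α : ℂ) * (a - w) = (t - κ : ℝ) * (b - w) := by
          simp only [real_smul] at hz; push_cast at hz ⊢; linear_combination -hz
        rw [e, cr_mul_left, cr_self, mul_zero]
      rcases mul_eq_zero.1 this with h | h
      · exact h1.ne' h
      · exact hcr h
    · exact h5 κ hκ l hl hli hl1 hz
  have hmemwa : ∀ t : ℝ, 0 ≤ t → t ≤ 1 → w + t * (a - w) ∈ K := fun t h0 h1 =>
    hdK i (by omega) ⟨t, 1 - t, h0, by linarith, by ring, by simp only [real_smul]; push_cast; ring⟩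
  have hmemwb : ∀ t : ℝ, 0 ≤ t → t ≤ 1 → w + t * (b - w) ∈ K := fun t h0 h1 =>
    hdK (i + 1) (by omega)
      ⟨1 - t, t, by linarith, h0, by ring, by simp only [real_smul]; push_cast; ring⟩
  by_cases hblk : Blocked K w a b
  · -- the obstacle at `w` lies inside the polygon and, in the direction `u`, beyond all edges
    -- that do not end at `w`
    obtain ⟨α, β, h1, h2, h3, h4, h5⟩ := hblk (min 1 (η₀ / (cr u w - cr u a + (cr u w - cr u b))))
      (by positivity)
    rw [lt_min_iff] at h2 h4
    have h6 := (lt_div_iff₀ (by positivity)).1 h2.2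
    have h7 := (lt_div_iff₀ (by positivity)).1 h4.2
    have hα : 0 < α := h1.lt_of_ne fun e => h5 (by
      rw [← e]; simpa using hmemwb β h3 h4.1.le)
    have hβ : 0 < β := h3.lt_of_ne fun e => h5 (by
      rw [← e]; simpa using hmemwa α h1 h2.1.le)
    refine hfin α β hα h2.1 hβ h5 fun κ hκ l hl hl1 hl2 hz => ?_
    have h8 := hgap' l hl hl1 hl2 _ hz
    rw [huz] at h8
    have h9 := mul_le_mul_of_nonneg_right hκ hB.le
    -- split the bound between the two coordinates according to which one is larger
    rcases le_total α β with h | h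
    · have := mul_le_mul_of_nonneg_right h hA.le
      nlinarith
    · have := mul_le_mul_of_nonneg_right h hB.le
      nlinarith
  · -- otherwise the obstacle at `b` lies inside the polygon
    have hneg : ε (i + 1) * cr (w - a) (b - w) < 0 := by
      rcases hnode i (by omega) with ⟨h, -⟩ | ⟨v, hv, hv2, ξ, η, hξ, hη, h⟩
      · exact absurd h hblk
      · rw [← ha, ← hw] at hv2
        rw [← ha, ← hw, ← hb] at h
        have e1 : cr (w - a) (b - w) = η * cr (w - a) (v - w) := by
          rw [h, cr_add_right, cr_mul_right, cr_mul_right, ← neg_sub w a, cr_neg_right, cr_self]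
          ring
        have hη' : η < 0 := hη.lt_of_ne fun h => hτ (by rw [e1, h, zero_mul])
        rw [e1]
        nlinarith
    have hpos := hlink i (by omega) hneg
    rw [← ha, ← hw, ← hb] at hpos
    obtain ⟨v, hv, hv2, hnext⟩ : ∃ v, Blocked K b w v ∧ 0 < ε (i + 2) * cr (b - w) (v - b) ∧
        ∀ s β t : ℝ, 0 ≤ s → 0 < β → 0 ≤ t →
          (s : ℂ) * (w - b) + β * (v - b) = t * (d (i + 3) - b) → s = 0 := by
      have hlin : ∀ v, 0 < ε (i + 2) * cr (b - w) (v - b) → ∀ x y : ℝ,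
          (x : ℂ) * (w - b) + y * (v - b) = 0 → x = 0 ∧ y = 0 := by
        intro v hv x y h
        have hwb : w - b ≠ 0 := fun h => by
          rw [← neg_sub w b, h] at hv
          simp [cr] at hv
        have e1 : y * cr (b - w) (v - b) = 0 := by
          have : cr (b - w) ((x : ℂ) * (w - b) + y * (v - b)) = 0 := by rw [h]; simp [cr]
          rwa [cr_add_right, cr_mul_right, cr_mul_right, ← neg_sub b w, cr_neg_right, cr_self,
            neg_zero, mul_zero, zero_add] at this
        have e2 : y = 0 := (mul_eq_zero.1 e1).resolve_right fun h => by rw [h] at hv; simp at hv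
        refine ⟨?_, e2⟩
        rw [e2] at h
        simpa [hwb] using h
      rcases hnode (i + 1) (by omega) with ⟨h1, h2⟩ | ⟨v, h1, h2, ξ, η, hξ, hη, h⟩
      · refine ⟨_, h1, h2, fun s β t hs hβ ht e => ?_⟩
        exact (hlin _ h2 s (β - t) (by push_cast; linear_combination e)).1
      · refine ⟨v, h1, h2, fun s β t hs hβ ht e => ?_⟩
        have := (hlin _ h2 (s - t * ξ) (β - t * η) (by
          push_cast; rw [h] at e; linear_combination e)).2
        nlinarith
    obtain ⟨p, q, hpq⟩ := exists_coords hcr (v - b)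
    have hp : 0 < p := by
      have e1 : cr (b - w) (v - b) = p * cr (w - a) (b - w) := by
        rw [hpq, cr_add_right, cr_mul_right, cr_mul_right, cr_self, cr_swap, ← neg_sub w a,
          cr_neg_left]
        ring
      rw [e1] at hv2
      by_contra! hn
      have : ε (i + 2) * (p * cr (w - a) (b - w)) = p * (ε (i + 2) * cr (w - a) (b - w)) := by ring
      nlinarith
    -- the edge `[w, b]` has positive distance from the edges that do not touch it
    obtain ⟨ρ, hρ, hdist⟩ : ∃ ρ : ℝ, 0 < ρ ∧ ∀ x ∈ segment ℝ w b, ∀ l ≤ m, l ≠ i → l ≠ i + 1 →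
        l ≠ i + 2 → ∀ z ∈ segment ℝ (d l) (d (l + 1)), ρ < ‖z - x‖ := by
      obtain ⟨ρ, hρ, h⟩ := Metric.exists_pos_forall_lt_edist (isCompact_segment w b)
        (t := ⋃ l ∈ {l | l ≤ m ∧ l ≠ i ∧ l ≠ i + 1 ∧ l ≠ i + 2}, segment ℝ (d l) (d (l + 1)))
        (Set.Finite.isClosed_biUnion ((finite_le_nat m).subset fun l hl => hl.1)
          fun l _ => (isCompact_segment _ _).isClosed) (by
        simp only [disjoint_iUnion_right]
        rintro l ⟨hl, h1, h2, h3⟩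
        rcases lt_or_ge l (i + 1) with h | h
        · exact (hdisj l (i + 1) (by omega) (by omega) (by omega)).symm
        · exact hdisj (i + 1) l (by omega) (by omega) (by omega))
      refine ⟨ρ, by exact_mod_cast hρ, fun x hx l hl h1 h2 h3 z hz => ?_⟩
      have := h x hx z (mem_biUnion (show l ∈ {l | l ≤ m ∧ l ≠ i ∧ l ≠ i + 1 ∧ l ≠ i + 2} from
        ⟨hl, h1, h2, h3⟩) hz)
      rw [edist_comm, edist_dist, dist_eq_norm] at this
      by_contra! hle
      have h4 := ENNReal.ofReal_le_ofReal hle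
      rw [ENNReal.ofReal_coe_nnreal] at h4
      exact absurd this (not_lt.2 h4)
    obtain ⟨D, hD⟩ : ∃ D, D = 1 + p + |q| +
        (p * (cr u w - cr u a) + |q| * (cr u w - cr u b)) / η₀ + ‖v - b‖ / ρ := ⟨_, rfl⟩
    have hD1 : 0 ≤ (p * (cr u w - cr u a) + |q| * (cr u w - cr u b)) / η₀ := by positivity
    have hD2 : 0 ≤ ‖v - b‖ / ρ := by positivity
    have hDpos : 1 ≤ D := by have := abs_nonneg q; linarith
    obtain ⟨α, β, h1, h2, h3, h4, h5⟩ := hv (1 / (2 * D)) (by positivity)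
    have h2' : α < 1 / 2 := by
      refine h2.trans_le ?_
      rw [div_le_div_iff₀ (by positivity) (by norm_num)]; linarith
    have h4' : β * D < 1 / 2 := by
      rw [lt_div_iff₀ (by positivity)] at h4; linarith
    have q0 := abs_nonneg q
    have b1 : β * p < 1 / 2 := by
      have : β * p ≤ β * D := by gcongr; linarith
      linarith
    have b2 : β * |q| < 1 / 2 := by
      have : β * |q| ≤ β * D := by gcongr; linarith
      linarith
    have b3 : β * (p * (cr u w - cr u a) + |q| * (cr u w - cr u b)) < η₀ := by
      have h : β * ((p * (cr u w - cr u a) + |q| * (cr u w - cr u b)) / η₀) ≤ β * D := by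
        gcongr; linarith
      have h' : β * ((p * (cr u w - cr u a) + |q| * (cr u w - cr u b)) / η₀) < 1 := by linarith
      rwa [← mul_div_assoc, div_lt_one hη₀] at h'
    have b4 : β * ‖v - b‖ < ρ := by
      have h : β * (‖v - b‖ / ρ) ≤ β * D := by gcongr; linarith
      have h' : β * (‖v - b‖ / ρ) < 1 := by linarith
      rwa [← mul_div_assoc, div_lt_one hρ] at h'
    have hβ : 0 < β := h3.lt_of_ne fun e => h5 (by
      have := hmemwb (1 - α) (by linarith) (by linarith)
      rw [← e]; convert this using 1; push_cast; ring)
    have hqβ : |β * q| < 1 / 2 := by rwa [abs_mul, abs_of_pos hβ]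
    rw [abs_lt] at hqβ
    have hz_eq : ∀ κ : ℝ, w + (β * p : ℝ) * (a - w) + (κ : ℝ) * (b - w) =
        b + (1 - κ + β * q : ℝ) * (w - b) + β * (v - b) := fun κ => by
      rw [hpq]; push_cast; ring
    have hzo : w + (β * p : ℝ) * (a - w) + (1 - α + β * q : ℝ) * (b - w) =
        b + α * (w - b) + β * (v - b) := by
      rw [hz_eq]; push_cast; ring
    have hqb : β * q ≤ β * |q| := mul_le_mul_of_nonneg_left (le_abs_self q) h3
    refine hfin (β * p) (1 - α + β * q) (by positivity) (by linarith) (by linarith)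
      (by rwa [hzo]) fun κ hκ l hl hl1 hl2 hz => ?_
    by_cases hl3 : l = i + 2
    · subst hl3
      rw [hz_eq] at hz
      have hz' := hz
      obtain ⟨s, t, hs, ht, hst, hz⟩ := hz
      obtain rfl : s = 1 - t := by linarith
      have hs0 := hnext (1 - κ + β * q) β t (by linarith) hβ ht (by
        rw [← hb] at hz
        simp only [real_smul] at hz; push_cast at hz ⊢; linear_combination -hz)
      have hα0 : α = 0 := by linarith
      apply h5
      rw [hs0] at hz'
      rw [hα0]
      exact hdK _ hl hz'
    · by_cases hκ1 : 1 - κ + β * q ≤ 1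
      · have hx : b + (1 - κ + β * q : ℝ) * (w - b) ∈ segment ℝ w b :=
          ⟨1 - κ + β * q, κ - β * q, by linarith, by linarith, by ring, by
            simp only [real_smul]; push_cast; ring⟩
        have h6 := hdist _ hx l hl hl1 hl2 hl3 _ hz
        rw [hz_eq, add_sub_cancel_left, norm_mul, norm_real, Real.norm_of_nonneg h3] at h6
        linarith
      · have h8 := hgap' l hl hl1 hl2 _ hz
        rw [huz] at h8
        have h9 : κ * (cr u w - cr u b) ≤ β * |q| * (cr u w - cr u b) := by
          gcongr; linarith
        nlinarith

/-! ### Simple trails -/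

lemma Node.not_backward {K : Set ℂ} {a c b : ℂ} {ε : ℝ} (h : Node K a c b ε) {r t : ℝ}
    (hr : 0 ≤ r) (ht : 0 < t) : (t : ℂ) * (b - c) ≠ r * (a - c) := by
  intro e
  have ht' := ht.ne'
  rcases h with ⟨-, h⟩ | ⟨v, -, hv, ξ, η, hξ, hη, h⟩
  · have : t * cr (c - a) (b - c) = 0 := by
      rw [← cr_mul_right, e, cr_mul_right, ← neg_sub a c, cr_neg_left, cr_self]; simp
    rw [(mul_eq_zero.1 this).resolve_left ht'] at h
    simp at h
  · have h0 : cr (c - a) (v - c) ≠ 0 := fun h => by rw [h] at hv; simp at hv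
    have hac : a - c ≠ 0 := fun h => h0 (by rw [← neg_sub a c, h]; simp [cr])
    have h1 : t * (η * cr (c - a) (v - c)) = 0 := by
      have : t * cr (c - a) (b - c) = 0 := by
        rw [← cr_mul_right, e, cr_mul_right, ← neg_sub a c, cr_neg_left, cr_self]; simp
      rw [h, cr_add_right, cr_mul_right, cr_mul_right, ← neg_sub a c, cr_neg_left, cr_self] at this
      rw [← neg_sub a c]
      linarith
    have h2 : η = 0 := (mul_eq_zero.1 ((mul_eq_zero.1 h1).resolve_left ht')).resolve_right h0
    rw [h, h2] at e
    have h3 : ((t * ξ - r : ℝ) : ℂ) * (a - c) = 0 := by push_cast at e ⊢; linear_combination e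
    have h4 : t * ξ - r = 0 := by exact_mod_cast (mul_eq_zero.1 h3).resolve_right hac
    nlinarith

/-- A polygonal trail `c 0, …, c n` in `K` that does not meet itself and whose inner vertices carry
obstacles on the sides given by `ε`; `ε n` is the side of the obstacle at the last vertex. By
`link`, if the trail turns away from the obstacle at `c (l + 1)`, then the next obstacle is on the
side to which it turns. So if `c (l + 1)` is exposed, one of these two obstacles is on the inner
side of the trail. -/
structure Trail (K : Set ℂ) (c : ℕ → ℂ) (ε : ℕ → ℝ) (n : ℕ) : Prop where
  subset : ∀ l < n, segment ℝ (c l) (c (l + 1)) ⊆ K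
  simple : ∀ l < n, ∀ k < l, ∀ t : ℝ, 0 < t → t ≤ 1 →
    c l + t * (c (l + 1) - c l) ∉ segment ℝ (c k) (c (k + 1))
  node : ∀ l, l + 1 < n → Node K (c l) (c (l + 1)) (c (l + 2)) (ε (l + 1))
  link : ∀ l, l + 1 < n → ε (l + 1) * cr (c (l + 1) - c l) (c (l + 2) - c (l + 1)) < 0 →
    0 < ε (l + 2) * cr (c (l + 1) - c l) (c (l + 2) - c (l + 1))

lemma mem_segment_iff {x y z : ℂ} :
    z ∈ segment ℝ x y ↔ ∃ t : ℝ, 0 ≤ t ∧ t ≤ 1 ∧ z = x + t * (y - x) := by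
  constructor
  · rintro ⟨s, t, hs, ht, hst, rfl⟩
    obtain rfl : s = 1 - t := by linarith
    exact ⟨t, ht, by linarith, by simp only [real_smul]; push_cast; ring⟩
  · rintro ⟨t, h0, h1, rfl⟩
    exact ⟨1 - t, t, by linarith, h0, by ring, by simp only [real_smul]; push_cast; ring⟩

lemma Trail.end_notMem {K : Set ℂ} {c : ℕ → ℂ} {ε : ℕ → ℝ} {n : ℕ} (h : Trail K c ε n) {l k : ℕ}
    (hl : l < n) (hk : k < l) : c (l + 1) ∉ segment ℝ (c k) (c (k + 1)) := by
  have := h.simple l hl k hk 1 one_pos le_rfl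
  rwa [ofReal_one, one_mul, add_sub_cancel] at this

lemma Trail.disjoint {K : Set ℂ} {c : ℕ → ℂ} {ε : ℕ → ℝ} {n : ℕ} (h : Trail K c ε n) {p q : ℕ}
    (hpq : p + 1 < q) (hq : q < n) :
    Disjoint (segment ℝ (c p) (c (p + 1))) (segment ℝ (c q) (c (q + 1))) := by
  rw [Set.disjoint_left]
  intro z hp hz
  obtain ⟨t, h0, h1, rfl⟩ := mem_segment_iff.1 hz
  rcases h0.eq_or_lt with rfl | h0
  · obtain ⟨q, rfl⟩ := Nat.exists_eq_succ_of_ne_zero (show q ≠ 0 by omega)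
    refine h.end_notMem (l := q) (by omega) (show p < q by omega) ?_
    simpa using hp
  · exact h.simple q hq p (by omega) t h0 h1 hp

/-- A trail with obstacles does not meet the next segment that continues it around or away from the
last obstacle: the first meeting point would close a simple polygon. -/
lemma Trail.not_mem_of_node {K : Set ℂ} (hK : IsCompact K) (hH : HoleFree K) {c : ℕ → ℂ}
    {ε : ℕ → ℝ} {n : ℕ} (h : Trail K c ε (n + 1)) {s : ℂ} (hs : segment ℝ (c (n + 1)) s ⊆ K)
    (hnode : Node K (c n) (c (n + 1)) s (ε (n + 1))) {k : ℕ} (hk : k < n + 1) {t : ℝ} (ht : 0 < t)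
    (ht1 : t ≤ 1) : c (n + 1) + t * (s - c (n + 1)) ∉ segment ℝ (c k) (c (k + 1)) := by
  intro hmem
  have hlast : ∀ t : ℝ, 0 < t → c (n + 1) + t * (s - c (n + 1)) ∉ segment ℝ (c n) (c (n + 1)) := by
    intro t ht hm
    rw [segment_symm, mem_segment_iff] at hm
    obtain ⟨r, hr, -, e⟩ := hm
    exact hnode.not_backward hr ht (by linear_combination e)
  have hkn : k < n := by
    rcases (Nat.lt_succ_iff.1 hk).eq_or_lt with rfl | h'
    · exact absurd hmem (hlast t ht)
    · exact h'
  -- the first meeting point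
  let Γ : Set ℂ := ⋃ k ∈ {k | k < n}, segment ℝ (c k) (c (k + 1))
  have hΓ : IsClosed Γ := Set.Finite.isClosed_biUnion (finite_lt_nat n) fun l _ =>
    (isCompact_segment _ _).isClosed
  let T : Set ℝ := Icc 0 1 ∩ (fun t : ℝ => c (n + 1) + t * (s - c (n + 1))) ⁻¹' Γ
  have hT : IsCompact T := isCompact_Icc.inter_right (hΓ.preimage (by fun_prop))
  obtain ⟨t₀, ⟨⟨ht0, ht01⟩, htΓ⟩, hmin⟩ := hT.exists_isLeast
    ⟨t, ⟨ht.le, ht1⟩, mem_biUnion (show k ∈ {k | k < n} from hkn) hmem⟩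
  have hmin' : ∀ t' : ℝ, 0 ≤ t' → t' < t₀ → ∀ k < n,
      c (n + 1) + t' * (s - c (n + 1)) ∉ segment ℝ (c k) (c (k + 1)) := fun t' h0 h1 k hk hm =>
    not_lt.2 (hmin ⟨⟨h0, by linarith⟩, mem_biUnion (show k ∈ {k | k < n} from hk) hm⟩) h1
  have ht0' : 0 < t₀ := by
    refine ht0.lt_of_ne ?_
    rintro rfl
    obtain ⟨k, hk, hm⟩ := mem_iUnion₂.1 htΓ
    refine h.end_notMem (Nat.lt_succ_self n) hk ?_
    simpa using hm
  obtain ⟨x, hx⟩ : ∃ x, x = c (n + 1) + t₀ * (s - c (n + 1)) := ⟨_, rfl⟩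
  -- the last edge through it
  obtain ⟨k, ⟨hkn, hxk⟩, hkmax⟩ : ∃ k, (k < n ∧ x ∈ segment ℝ (c k) (c (k + 1))) ∧
      ∀ l, k < l → l < n → x ∉ segment ℝ (c l) (c (l + 1)) := by
    classical
    have hex : ∃ k ∈ Finset.range n, x ∈ segment ℝ (c k) (c (k + 1)) := by
      obtain ⟨k, hk, hm⟩ := mem_iUnion₂.1 htΓ
      exact ⟨k, Finset.mem_range.2 hk, hx ▸ hm⟩
    obtain ⟨k0, hk0, hm0⟩ := hex
    obtain ⟨k, hk, hmax⟩ := ((Finset.range n).filter fun k => x ∈ segment ℝ (c k) (c (k + 1)))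
      |>.exists_max_image id ⟨k0, Finset.mem_filter.2 ⟨hk0, hm0⟩⟩
    simp only [Finset.mem_filter, Finset.mem_range, id] at hk hmax
    exact ⟨k, hk, fun l hl hln hxl => absurd (hmax l ⟨hln, hxl⟩) (by omega)⟩
  have hxn : x ∉ segment ℝ (c n) (c (n + 1)) := hx ▸ hlast t₀ ht0'
  have hxne : x ≠ c (k + 1) := by
    rintro rfl
    rcases (Nat.succ_le_iff.2 hkn).eq_or_lt with h' | h'
    · rw [Nat.succ_eq_add_one] at h'
      rw [h'] at hxn
      exact hxn (left_mem_segment ℝ _ _)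
    · exact hkmax (k + 1) (by omega) h' (left_mem_segment ℝ _ _)
  obtain ⟨r, hr0, hr1, hr⟩ : ∃ r : ℝ, 0 < r ∧ r ≤ 1 ∧ x - c (k + 1) = r * (c k - c (k + 1)) := by
    rw [segment_symm, mem_segment_iff] at hxk
    obtain ⟨r, h0, h1, e⟩ := hxk
    refine ⟨r, h0.lt_of_ne ?_, h1, by linear_combination e⟩
    rintro rfl
    exact hxne (by simpa using e)
  obtain ⟨m, rfl⟩ : ∃ m, n = k + m + 1 := ⟨n - k - 1, by omega⟩
  let d : ℕ → ℂ := fun l => if l = 0 ∨ l = m + 3 then x else c (k + l)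
  have d0 : d 0 = x := by simp [d]
  have dl : d (m + 3) = x := by simp [d]
  have dmid : ∀ l, l < m + 2 → d (l + 1) = c (k + l + 1) := fun l hl => by
    simp only [d]; rw [if_neg (by omega)]; rfl
  have hedge0 : segment ℝ (d 0) (d 1) ⊆ segment ℝ (c k) (c (k + 1)) := by
    rw [d0, dmid 0 (by omega)]
    exact (convex_segment _ _).segment_subset hxk (right_mem_segment ℝ _ _)
  have hedge : ∀ l, l < m + 1 → segment ℝ (d (l + 1)) (d (l + 2)) =
      segment ℝ (c (k + l + 1)) (c (k + l + 2)) := fun l hl => by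
    rw [dmid l (by omega), dmid (l + 1) (by omega)]; rfl
  have hedge' : ∀ l, l < m + 2 → segment ℝ (d l) (d (l + 1)) ⊆
      segment ℝ (c (k + l)) (c (k + l + 1)) := fun l hl => by
    rcases l with - | l
    · exact hedge0
    · rw [hedge l (by omega)]; rfl
  have hedgem : ∀ z ∈ segment ℝ (d (m + 2)) (d (m + 3)), ∃ t' : ℝ, 0 ≤ t' ∧ t' ≤ t₀ ∧
      z = c (k + m + 2) + t' * (s - c (k + m + 2)) := fun z hz => by
    rw [dl, dmid (m + 1) (by omega), mem_segment_iff] at hz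
    obtain ⟨t', h0, h1, rfl⟩ := hz
    refine ⟨t' * t₀, by positivity, mul_le_of_le_one_left ht0 h1, ?_⟩
    rw [hx]; push_cast
    have : k + (m + 1) + 1 = k + m + 1 + 1 := by omega
    rw [this]; ring
  have hlastpt : ∀ l, l < m + 1 → c (k + m + 2) ∉ segment ℝ (c (k + l)) (c (k + l + 1)) :=
    fun l hl => h.end_notMem (l := k + m + 1) (by omega) (by omega)
  have hxm : d (m + 3) - c (k + m + 2) = t₀ * (s - c (k + m + 2)) := by
    rw [dl, hx]; ring
  refine false_of_closed_trail hK hH d (fun l => ε (k + l)) (m := m + 2) (by rw [dl, d0]) ?_ ?_ ?_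
    (by omega) ?_ ?_ ?_
  · intro l hl
    rcases hl.eq_or_lt with rfl | hl
    · intro z hz
      obtain ⟨t', h0, h1, rfl⟩ := hedgem z hz
      exact hs (mem_segment_iff.2 ⟨t', h0, by linarith, rfl⟩)
    · exact (hedge' l hl).trans (h.subset _ (by omega))
  · intro i j hij hj
    obtain ⟨j, rfl⟩ := Nat.exists_eq_succ_of_ne_zero (show j ≠ 0 by omega)
    rw [Nat.succ_eq_add_one, dmid j (by omega)]
    rcases i with - | i
    · rw [d0]
      rcases j with - | j
      · exact hxne
      · rintro rfl
        exact h.end_notMem (l := k + j + 1) (by omega) (show k < k + j + 1 by omega) hxk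
    · rw [dmid i (by omega)]
      intro e
      refine h.end_notMem (l := k + j) (k := k + i) (by omega) (by omega) ?_
      rw [← e]
      exact right_mem_segment ℝ _ _
  · intro i j hij hj hnot
    rcases hj.eq_or_lt with rfl | hj
    · rw [Set.disjoint_right]
      intro z hz hzi
      have hzi' := hedge' i (by omega) hzi
      obtain ⟨t', h0, h1, rfl⟩ := hedgem z hz
      rcases h1.eq_or_lt with rfl | h1
      · refine hkmax (k + i) (by omega) (by omega) ?_
        rw [hx]; exact hzi'
      · exact hmin' t' h0 h1 (k + i) (by omega) hzi'
    · exact (h.disjoint (p := k + i) (q := k + j) (by omega) (by omega)).mono (hedge' i (by omega))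
        (hedge' j (by omega))
  · intro hmem
    obtain ⟨t', h0, h1, e⟩ := hedgem _ hmem
    rw [dmid 0 (by omega)] at e
    rcases h1.eq_or_lt with rfl | h1
    · exact hxne (by rw [hx]; exact e.symm)
    · refine hmin' t' h0 h1 k (by omega) ?_
      have : c (k + m + 1 + 1) + t' * (s - c (k + m + 1 + 1)) = c (k + 1) := e.symm
      rw [this]
      exact right_mem_segment ℝ _ _
  · intro j hj
    have hN : Node K (c (k + j)) (c (k + j + 1)) (if j = m + 1 then s else c (k + j + 2))
        (ε (k + j + 1)) := by
      split_ifs with hjm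
      · subst hjm; exact hnode
      · exact h.node (k + j) (by omega)
    rw [dmid j (by omega)]
    refine hN.rescale (s := if j = 0 then r else 1) (t := if j = m + 1 then t₀ else 1)
      (by split_ifs <;> simp [hr0]) (by split_ifs <;> simp [ht0']) ?_ ?_
    · split_ifs with h0
      · subst h0; rw [d0]; exact hr
      · obtain ⟨j, rfl⟩ := Nat.exists_eq_succ_of_ne_zero h0
        rw [Nat.succ_eq_add_one, dmid j (by omega)]; push_cast; rw [one_mul]; rfl
    · split_ifs with h0
      · subst h0; exact hxm
      · rw [dmid (j + 1) (by omega)]; push_cast; rw [one_mul]; rfl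
  · intro j hj
    have hL := h.link (k + j) (by omega)
    rw [dmid j (by omega), dmid (j + 1) (by omega)]
    have e : c (k + j + 1) - d j = (if j = 0 then r else 1 : ℝ) * (c (k + j + 1) - c (k + j)) := by
      split_ifs with h0
      · subst h0; rw [d0]; linear_combination -hr
      · obtain ⟨j, rfl⟩ := Nat.exists_eq_succ_of_ne_zero h0
        rw [Nat.succ_eq_add_one, dmid j (by omega)]; push_cast; rw [one_mul]; rfl
    rw [e, cr_mul_left]
    have hpos : 0 < (if j = 0 then r else 1 : ℝ) := by split_ifs <;> simp [hr0]
    set ρ := (if j = 0 then r else 1 : ℝ)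
    intro hneg
    have h1 := hL (by
      by_contra! hn
      have := mul_nonneg hpos.le hn
      have e2 : ρ * (ε (k + j + 1) *
          cr (c (k + j + 1) - c (k + j)) (c (k + j + 2) - c (k + j + 1))) =
        ε (k + (j + 1)) *
          (ρ * cr (c (k + j + 1) - c (k + j)) (c (k + (j + 1) + 1) - c (k + j + 1))) := by
        have : k + (j + 1) + 1 = k + j + 2 := by omega
        rw [this]; show _ = ε (k + j + 1) * _; ring
      linarith)
    have e2 : ε (k + (j + 2)) *
        (ρ * cr (c (k + j + 1) - c (k + j)) (c (k + (j + 1) + 1) - c (k + j + 1)))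
        = ρ * (ε (k + j + 2) * cr (c (k + j + 1) - c (k + j)) (c (k + j + 2) - c (k + j + 1))) := by
      have : k + (j + 1) + 1 = k + j + 2 := by omega
      rw [this]; show ε (k + j + 2) * _ = _; ring
    rw [e2]
    positivity

/-! ### Scenes and tangent points -/

lemma HoleFree.mem_of_corner {K : Set ℂ} (hH : HoleFree K) {c g s : ℂ} (h1 : segment ℝ c g ⊆ K)
    (h2 : segment ℝ g s ⊆ K) (h3 : segment ℝ c s ⊆ K) {p q : ℝ} (hp : 0 ≤ p) (hq : 0 ≤ q)
    (hpq : p + q ≤ 1) : c + p * (g - c) + q * (s - c) ∈ K := by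
  have := hH.triangle_subset h1 h2 h3 (r := 1 - p - q) (by linarith) hp hq (by ring)
  convert this using 1
  push_cast; ring

lemma cross_ne_zero_of_not_seen {K : Set ℂ} {p q x : ℂ} (hpq : segment ℝ p q ⊆ K)
    (hqx : segment ℝ q x ⊆ K) (hpx : ¬ segment ℝ p x ⊆ K) : cr (q - p) (x - p) ≠ 0 := by
  intro h
  apply hpx
  by_cases hqp : q = p
  · rwa [← hqp]
  obtain ⟨t, ht⟩ := exists_real_mul_of_cr_eq_zero (sub_ne_zero.2 hqp) h
  intro z hz
  obtain ⟨r, h0, h1, rfl⟩ := mem_segment_iff.1 hz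
  have hx : x = p + t * (q - p) := by linear_combination ht
  rcases lt_or_ge t 0 with hneg | hnn
  · refine hqx (mem_segment_iff.2 ⟨(1 - r * t) / (1 - t), div_nonneg (by nlinarith) (by linarith),
      ?_, ?_⟩)
    · rw [div_le_one (by linarith)]; nlinarith
    · have : (1 - t : ℂ) ≠ 0 := by exact_mod_cast (show (1 - t : ℝ) ≠ 0 by linarith)
      rw [hx]; push_cast; field_simp; ring
  · rcases le_or_gt (r * t) 1 with hle | hgt
    · exact hpq (mem_segment_iff.2 ⟨r * t, by positivity, hle, by rw [hx]; push_cast; ring⟩)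
    · have ht1 : 1 < t := by nlinarith
      refine hqx (mem_segment_iff.2 ⟨(r * t - 1) / (t - 1), div_nonneg (by linarith) (by linarith),
        ?_, ?_⟩)
      · rw [div_le_one (by linarith)]; nlinarith
      · have : (t - 1 : ℂ) ≠ 0 := by exact_mod_cast (show (t - 1 : ℝ) ≠ 0 by linarith)
        rw [hx]; push_cast; field_simp; ring

/-- The parameter `τ` gives the last point of the segment from `q` to `x` that is seen from `p`. -/
def IsLastSeen (K : Set ℂ) (p q x : ℂ) (τ : ℝ) : Prop :=
  0 ≤ τ ∧ τ ≤ 1 ∧ segment ℝ p (q + τ * (x - q)) ⊆ K ∧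
    ∀ σ : ℝ, τ < σ → σ ≤ 1 → ¬ segment ℝ p (q + σ * (x - q)) ⊆ K

lemma exists_isLastSeen {K : Set ℂ} (hK : IsClosed K) {p q : ℂ} (hpq : segment ℝ p q ⊆ K) (x : ℂ) :
    ∃ τ, IsLastSeen K p q x τ := by
  let T : Set ℝ := Icc 0 1 ∩ ⋂ t ∈ Icc (0 : ℝ) 1,
    (fun τ : ℝ => p + t * (q + τ * (x - q) - p)) ⁻¹' K
  have hseg : ∀ τ : ℝ, segment ℝ p (q + τ * (x - q)) ⊆ K ↔
      τ ∈ ⋂ t ∈ Icc (0 : ℝ) 1, (fun τ : ℝ => p + t * (q + τ * (x - q) - p)) ⁻¹' K := fun τ => by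
    simp only [mem_iInter, mem_preimage]
    constructor
    · intro h t ht
      exact h (mem_segment_iff.2 ⟨t, ht.1, ht.2, rfl⟩)
    · intro h z hz
      obtain ⟨t, h0, h1, rfl⟩ := mem_segment_iff.1 hz
      exact h t ⟨h0, h1⟩
  have hT : IsCompact T := isCompact_Icc.inter_right
    (isClosed_biInter fun t _ => hK.preimage (by fun_prop))
  obtain ⟨τ, ⟨⟨h0, h1⟩, hτ⟩, hmax⟩ := hT.exists_isGreatest
    ⟨0, ⟨le_rfl, zero_le_one⟩, (hseg 0).1 (by simpa using hpq)⟩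
  refine ⟨τ, h0, h1, (hseg τ).2 hτ, fun σ hσ hσ1 hs => ?_⟩
  exact not_lt.2 (hmax ⟨⟨h0.trans hσ.le, hσ1⟩, (hseg σ).1 hs⟩) hσ

/-- Points off `K` within the triangle `p y x` accumulate at `s`. -/
def Touched (K : Set ℂ) (p y x s : ℂ) : Prop :=
  ∀ δ > 0, ∃ α β : ℝ, 0 ≤ α ∧ 0 ≤ β ∧ α + β ≤ 1 ∧ ‖p + α * (y - p) + β * (x - p) - s‖ < δ ∧
    p + α * (y - p) + β * (x - p) ∉ K

/-- A finite set `V` of points of a compact plane set `K` without holes, connected by visibility,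
that contains the points at which lines of sight get stuck: if `p` and `x` see `q` but not each
other, then the last line of sight from `p` to the segment `[q, x]` is stopped at a point of `V`.
The vertex set of a polygon has this property, and vertices may be removed one by one without
destroying it, whereas removing them from the polygon could make it degenerate. -/
structure Scene (K V : Set ℂ) : Prop where
  compact : IsCompact K
  holeFree : HoleFree K
  finite : V.Finite
  subset : V ⊆ K
  conn : ∀ S ⊆ V, S.Nonempty → S ≠ V → ∃ a ∈ S, ∃ b ∈ V \ S, segment ℝ a b ⊆ K
  tangent : ∀ p ∈ V, ∀ q ∈ V, ∀ x ∈ V, segment ℝ p q ⊆ K → segment ℝ q x ⊆ K → ∀ τ,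
    IsLastSeen K p q x τ → τ < 1 → ∃ s ∈ V, s ≠ p ∧ s ∈ segment ℝ p (q + τ * (x - q)) ∧
      Touched K p (q + τ * (x - q)) x s

lemma abs_cr_le (a b : ℂ) : |cr a b| ≤ 2 * ‖a‖ * ‖b‖ := by
  have h1 := abs_re_le_norm a
  have h2 := abs_im_le_norm a
  have h3 := abs_re_le_norm b
  have h4 := abs_im_le_norm b
  calc |cr a b| ≤ |a.re * b.im| + |a.im * b.re| := abs_sub _ _
    _ = |a.re| * |b.im| + |a.im| * |b.re| := by rw [abs_mul, abs_mul]
    _ ≤ ‖a‖ * ‖b‖ + ‖a‖ * ‖b‖ := by gcongr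
    _ = _ := by ring

/-- The coordinates of a vector in a basis are bounded by a multiple of its norm. -/
lemma exists_coord_bound {a b : ℂ} (h : cr a b ≠ 0) :
    ∃ C > 0, ∀ A B : ℝ, |A| ≤ C * ‖(A : ℂ) * a + B * b‖ ∧ |B| ≤ C * ‖(A : ℂ) * a + B * b‖ := by
  have hpos := abs_pos.2 h
  refine ⟨(2 * ‖a‖ + 2 * ‖b‖ + 1) / |cr a b|, by positivity, fun A B => ?_⟩
  have e1 : cr ((A : ℂ) * a + B * b) b = A * cr a b := by
    rw [cr_add_left, cr_mul_left, cr_mul_left, cr_self]; ring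
  have e2 : cr a ((A : ℂ) * a + B * b) = B * cr a b := by
    rw [cr_add_right, cr_mul_right, cr_mul_right, cr_self]; ring
  have b1 := abs_cr_le ((A : ℂ) * a + B * b) b
  have b2 := abs_cr_le a ((A : ℂ) * a + B * b)
  rw [e1, abs_mul] at b1
  rw [e2, abs_mul] at b2
  set N := ‖(A : ℂ) * a + B * b‖
  have hN : 0 ≤ N := norm_nonneg _
  have n1 : 0 ≤ ‖a‖ * N := by positivity
  have n2 : 0 ≤ ‖b‖ * N := by positivity
  rw [div_mul_eq_mul_div, le_div_iff₀ hpos, le_div_iff₀ hpos]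
  constructor <;> nlinarith

/-- Around a point where a line of sight is stopped, there is a blocked corner: if the last line of
sight from `p` to `[q, x]` is stopped at `s`, choosing `s` as far as possible along this line, then
`s` sees a point `v` of `V` beyond, and the corner at `s` between `p` and `v` is blocked. -/
lemma Scene.exists_tangent {K V : Set ℂ} (h : Scene K V) {p q x : ℂ} (hp : p ∈ V) (hq : q ∈ V)
    (hx : x ∈ V) (hpq : segment ℝ p q ⊆ K) (hqx : segment ℝ q x ⊆ K) {τ : ℝ}
    (hτ : IsLastSeen K p q x τ) (hτ1 : τ < 1) :
    ∃ s ∈ V, ∃ v ∈ V, ∃ t : ℝ, 0 < t ∧ t ≤ 1 ∧ s = p + t * (q + τ * (x - q) - p) ∧ s ≠ p ∧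
      Touched K p (q + τ * (x - q)) x s ∧ segment ℝ p s ⊆ K ∧ segment ℝ q s ⊆ K ∧
      segment ℝ s v ⊆ K ∧ Blocked K s p v ∧ 0 < cr (q - p) (x - p) * cr (s - p) (v - s) := by
  have hE : cr (q - p) (x - p) ≠ 0 := cross_ne_zero_of_not_seen hpq hqx (by
    have := hτ.2.2.2 1 hτ1 le_rfl
    simpa using this)
  obtain ⟨y, hy⟩ : ∃ y, y = q + τ * (x - q) := ⟨_, rfl⟩
  have hpy : segment ℝ p y ⊆ K := hy ▸ hτ.2.2.1
  have hyqx : y ∈ segment ℝ q x := mem_segment_iff.2 ⟨τ, hτ.1, hτ.2.1, hy⟩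
  have hqy : segment ℝ q y ⊆ K :=
    ((convex_segment q x).segment_subset (left_mem_segment ℝ q x) hyqx).trans hqx
  rw [← hy]
  let W : Set ℂ := {s | s ∈ V ∧ s ≠ p ∧ s ∈ segment ℝ p y ∧ Touched K p y x s}
  obtain ⟨s, ⟨hsV, hsp, hsy, hsT⟩, hmax⟩ := Set.exists_max_image W (fun s => ‖s - p‖)
    (h.finite.subset fun s hs => hs.1) (by
      obtain ⟨s, h1, h2, h3, h4⟩ := h.tangent p hp q hq x hx hpq hqx τ hτ hτ1
      exact ⟨s, h1, h2, hy ▸ h3, hy ▸ h4⟩)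
  have hps : segment ℝ p s ⊆ K :=
    ((convex_segment p y).segment_subset (left_mem_segment ℝ p y) hsy).trans hpy
  have hsyK : segment ℝ s y ⊆ K :=
    ((convex_segment p y).segment_subset hsy (right_mem_segment ℝ p y)).trans hpy
  obtain ⟨t, ht0, ht1, hst⟩ := mem_segment_iff.1 hsy
  have ht : 0 < t := ht0.lt_of_ne (by rintro rfl; exact hsp (by simpa using hst))
  have hsp' : s - p = t * (y - p) := by rw [hst]; ring
  have hyp : y - p ≠ 0 := fun e => hsp (sub_eq_zero.1 (by rw [hsp', e, mul_zero]))
  have hqs : segment ℝ q s ⊆ K := by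
    intro z hz
    obtain ⟨r, h0, h1, rfl⟩ := mem_segment_iff.1 hz
    have := h.holeFree.mem_of_corner hpq hqy hpy (p := 1 - r) (q := r * t) (by linarith)
      (by positivity) (by nlinarith)
    convert this using 1
    rw [hst]; push_cast; ring
  obtain ⟨τ₂, hτ₂⟩ := exists_isLastSeen h.compact.isClosed (p := s) (q := q)
    (by rwa [segment_symm]) x
  obtain ⟨y₂, hy₂⟩ : ∃ y₂, y₂ = q + τ₂ * (x - q) := ⟨_, rfl⟩
  have hsy₂ : segment ℝ s y₂ ⊆ K := hy₂ ▸ hτ₂.2.2.1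
  have hττ : τ ≤ τ₂ := by
    by_contra! hlt
    exact hτ₂.2.2.2 τ hlt hτ.2.1 (hy ▸ hsyK)
  obtain ⟨v, hvV, r, hr0, hr1, hv, hlt⟩ : ∃ v ∈ V, ∃ r : ℝ, 0 < r ∧ r ≤ 1 ∧ v - s = r * (y₂ - s) ∧
      τ < τ₂ := by
    rcases hτ₂.2.1.eq_or_lt with e | hlt
    · refine ⟨x, hx, 1, one_pos, le_rfl, ?_, e ▸ hτ1⟩
      rw [hy₂, e]; push_cast; ring
    · obtain ⟨v, hvV, hvs, hvy, hvT⟩ := h.tangent s hsV q hq x hx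
        (by rwa [segment_symm]) hqx τ₂ hτ₂ hlt
      rw [← hy₂] at hvy hvT
      obtain ⟨r, hr0, hr1, hv⟩ := mem_segment_iff.1 hvy
      have hr : 0 < r := hr0.lt_of_ne (by rintro rfl; exact hvs (by simpa using hv))
      refine ⟨v, hvV, r, hr, hr1, by rw [hv]; ring, hττ.lt_of_ne fun e => ?_⟩
      -- otherwise `v` would be farther along the same line of sight
      have hyy : y₂ = y := by rw [hy₂, hy, e]
      rw [hyy] at hv hvT
      have hv' : v - p = (t + r * (1 - t) : ℝ) * (y - p) := by
        rw [hv, hst]; push_cast; ring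
      have ht1' : t < 1 := ht1.lt_of_ne (by
        rintro rfl
        have : s = y := by rw [hst]; push_cast; ring
        exact hvs (by rw [hv, this]; ring))
      have hpos : t < t + r * (1 - t) := by nlinarith
      have hvW : v ∈ W := by
        refine ⟨hvV, fun e => ?_, ?_, ?_⟩
        · rw [e, sub_self] at hv'
          have := (mul_eq_zero.1 hv'.symm).resolve_right hyp
          have h0 : t + r * (1 - t) = 0 := by exact_mod_cast this
          linarith
        · refine mem_segment_iff.2 ⟨t + r * (1 - t), by linarith, by nlinarith, ?_⟩
          linear_combination hv'
        · intro δ hδ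
          obtain ⟨α, β, h1, h2, h3, h4, h5⟩ := hvT δ hδ
          have e2 : s + α * (y - s) + β * (x - s) =
              p + (t * (1 - α - β) + α : ℝ) * (y - p) + β * (x - p) := by
            rw [hst]; push_cast; ring
          rw [e2] at h4 h5
          exact ⟨_, _, by nlinarith, h2, by nlinarith, h4, h5⟩
      have h6 := hmax v hvW
      rw [hv', hsp', norm_mul, norm_mul, norm_real, norm_real, Real.norm_of_nonneg (by linarith),
        Real.norm_of_nonneg ht0] at h6
      have := norm_pos_iff.2 hyp
      nlinarith
  have hd : 0 < τ₂ - τ := sub_pos.2 hlt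
  have hy₂s : y₂ - s = (1 - t : ℝ) * (y - p) + (τ₂ - τ : ℝ) * (x - q) := by
    rw [hst, hy₂]; push_cast
    linear_combination (-1 : ℂ) * hy
  have hcr0 : cr (y - p) (x - q) = cr (q - p) (x - p) := by
    rw [hy]; simp only [cr, add_re, add_im, sub_re, sub_im, re_ofReal_mul, im_ofReal_mul]; ring
  have hcr1 : cr (s - p) (y₂ - s) = t * (τ₂ - τ) * cr (q - p) (x - p) := by
    rw [hsp', hy₂s, cr_mul_left, cr_add_right, cr_mul_right, cr_mul_right, cr_self, hcr0]; ring
  have hvy₂ : segment ℝ s v ⊆ K := by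
    refine Subset.trans ((convex_segment s y₂).segment_subset (left_mem_segment ℝ s y₂) ?_) hsy₂
    exact mem_segment_iff.2 ⟨r, hr0.le, hr1, by linear_combination hv⟩
  refine ⟨s, hsV, v, hvV, t, ht, ht1, hst, hsp, hsT, hps, hqs, hvy₂, ?_, ?_⟩
  · have hr' : (r : ℂ) ≠ 0 := by exact_mod_cast hr0.ne'
    refine Blocked.rescale (a := p) (v := y₂) ?_ one_pos (inv_pos.2 hr0) (by simp)
      (by rw [hv]; push_cast; field_simp)
    have hcr2 : cr (p - s) (y₂ - s) ≠ 0 := by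
      rw [← neg_sub s p, cr_neg_left, hcr1, neg_ne_zero]
      positivity
    obtain ⟨C, hC, hbound⟩ := exists_coord_bound hcr2
    intro ε hε
    obtain ⟨α, β, h1, h2, h3, h4, h5⟩ := hsT
      (min (ε / C) ((1 - t) / (C * 2) + if t = 1 then 1 else 0))
      (lt_min (by positivity) (by
        split_ifs with e
        · rw [e]; simp
        · have : 0 < 1 - t := sub_pos.2 (ht1.lt_of_ne e)
          positivity))
    rw [lt_min_iff] at h4
    obtain ⟨B, hB⟩ : ∃ B, B = β * (1 - τ) / (τ₂ - τ) := ⟨_, rfl⟩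
    obtain ⟨A, hA⟩ : ∃ A, A = (t - α - β + (1 - t) * B) / t := ⟨_, rfl⟩
    have hB0 : 0 ≤ B := by rw [hB]; exact div_nonneg (mul_nonneg h2 (by linarith)) hd.le
    have hBe : B * (τ₂ - τ) = β * (1 - τ) := by rw [hB]; field_simp
    have hAe : A * t = t - α - β + (1 - t) * B := by rw [hA]; field_simp
    have hos : p + α * (y - p) + β * (x - p) - s = A * (p - s) + B * (y₂ - s) := by
      have e1 : (B : ℂ) * (τ₂ - τ) = β * (1 - τ) := by exact_mod_cast hBe
      have e2 : (A : ℂ) * t = t - α - β + (1 - t) * B := by exact_mod_cast hAe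
      rw [hy₂s, hst]; push_cast
      linear_combination (x - q) * (-e1) + (y - p) * e2 - β * hy
    have hb := hbound A B
    rw [← hos] at hb
    have hos' : p + α * (y - p) + β * (x - p) = s + A * (p - s) + B * (y₂ - s) := by
      linear_combination hos
    have hNε : C * ‖p + α * (y - p) + β * (x - p) - s‖ < ε := by
      have := h4.1
      rw [lt_div_iff₀ hC] at this
      linarith
    rcases le_or_gt 0 A with hA0 | hA0
    · refine ⟨A, B, hA0, (le_abs_self A).trans_lt (hb.1.trans_lt hNε), hB0,
        (le_abs_self B).trans_lt (hb.2.trans_lt hNε), ?_⟩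
      rwa [← hos']
    · -- such points lie in the visible triangle `s`, `y`, `y₂`
      exfalso
      have htne : t ≠ 1 := by
        rintro rfl
        rw [mul_one] at hAe
        linarith
      have ht' : 0 < 1 - t := sub_pos.2 (ht1.lt_of_ne htne)
      have hN2 := h4.2
      rw [if_neg htne, add_zero, lt_div_iff₀ (by positivity)] at hN2
      have hA1 : -A ≤ (1 - t) / 2 := by
        have := (neg_le_abs A).trans hb.1
        linarith
      have hB1 : B ≤ (1 - t) / 2 := by
        have := (le_abs_self B).trans hb.2
        linarith
      apply h5
      have hyy₂ : segment ℝ y y₂ ⊆ K :=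
        ((convex_segment q x).segment_subset hyqx
          (mem_segment_iff.2 ⟨τ₂, hτ₂.1, hτ₂.2.1, hy₂⟩)).trans hqx
      have e3 : -A * t / (1 - t) ≤ 1 / 2 := by
        rw [div_le_iff₀ ht']
        nlinarith
      have := h.holeFree.mem_of_corner hsyK hyy₂ hsy₂ (p := -A * t / (1 - t)) (q := B)
        (div_nonneg (mul_nonneg (by linarith) ht0) ht'.le) hB0 (by linarith)
      rw [hos']
      convert this using 2
      have e4 : (1 - t : ℂ) ≠ 0 := by exact_mod_cast ht'.ne'
      rw [hst]; push_cast; field_simp; ring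
  · rw [hv, cr_mul_right, hcr1]
    have : 0 < cr (q - p) (x - p) * cr (q - p) (x - p) := mul_self_pos.2 hE
    have e : cr (q - p) (x - p) * (r * (t * (τ₂ - τ) * cr (q - p) (x - p))) =
      r * (t * (τ₂ - τ)) * (cr (q - p) (x - p) * cr (q - p) (x - p)) := by ring
    rw [e]
    positivity

/-! ### Removing points from a scene, and the pursuit -/

/-- `c` sees every point of `V` that `g` sees. -/
def SeesAllOf (K V : Set ℂ) (c g : ℂ) : Prop :=
  ∀ z ∈ V, segment ℝ g z ⊆ K → segment ℝ c z ⊆ K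

/-- All points of `V` that `g` sees lie strictly on one side of a line through `g`. -/
def Exposed (K V : Set ℂ) (g : ℂ) : Prop :=
  ∃ l : ℂ, ∀ z ∈ V, z ≠ g → segment ℝ g z ⊆ K → cr l z < cr l g

lemma segment_self_subset {K : Set ℂ} {x : ℂ} (h : x ∈ K) : segment ℝ x x ⊆ K := by
  rw [segment_same]; simpa using h

/-- Removing a dominated exposed point leaves a scene: no line of sight is stopped at such a
point, because the triangles it spans with the dominating point leave no room for an obstacle. -/
lemma Scene.remove {K V : Set ℂ} (h : Scene K V) {g c : ℂ} (hg : g ∈ V) (hc : c ∈ V) (hcg : c ≠ g)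
    (hdom : SeesAllOf K V c g) (hex : Exposed K V g) : Scene K (V \ {g}) where
  compact := h.compact
  holeFree := h.holeFree
  finite := h.finite.subset sdiff_subset
  subset := sdiff_subset.trans h.subset
  conn S hS hne hSV := by
    have hSV' : S ⊆ V := hS.trans sdiff_subset
    have hgS : g ∉ S := fun hgS => (hS hgS).2 rfl
    by_cases hcS : c ∈ S
    · -- move an edge leaving `S ∪ {g}` from `g` to `c`
      obtain ⟨a, ha, b, hb, hab⟩ := h.conn (insert g S) (insert_subset hg hSV')
        (insert_nonempty _ _)
        (fun e => hSV (by
          rw [← e, insert_sdiff_of_mem _ (mem_singleton g), sdiff_singleton_eq_self hgS]))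
      have hbg : b ≠ g := fun e => hb.2 (e ▸ mem_insert _ _)
      have hbS : b ∉ S := fun e => hb.2 (mem_insert_of_mem _ e)
      rcases eq_or_ne a g with rfl | hag
      · exact ⟨c, hcS, b, ⟨⟨hb.1, hbg⟩, hbS⟩, hdom b hb.1 hab⟩
      · exact ⟨a, mem_of_mem_insert_of_ne ha hag, b, ⟨⟨hb.1, hbg⟩, hbS⟩, hab⟩
    · obtain ⟨a, ha, b, hb, hab⟩ := h.conn S hSV' hne (fun e => hgS (e ▸ hg))
      rcases eq_or_ne b g with rfl | hbg
      · refine ⟨a, ha, c, ⟨⟨hc, hcg⟩, hcS⟩, ?_⟩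
        rw [segment_symm] at hab ⊢
        exact hdom a (hSV' ha) hab
      · exact ⟨a, ha, b, ⟨⟨hb.1, hbg⟩, hb.2⟩, hab⟩
  tangent p hp q hq x hx hpq hqx τ hτ hτ1 := by
    obtain ⟨s, hs, v, hv, t, ht0, ht1, hst, hsp, hsT, hps, hqs, hsv, hblk, hcr⟩ :=
      h.exists_tangent hp.1 hq.1 hx.1 hpq hqx hτ hτ1
    refine ⟨s, ⟨hs, ?_⟩, hsp, mem_segment_iff.2 ⟨t, ht0.le, ht1, hst⟩, hsT⟩
    rintro rfl
    have hsp' : segment ℝ s p ⊆ K := by rwa [segment_symm]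
    have hvs : v ≠ s := by rintro rfl; simp [cr] at hcr
    have hcs : segment ℝ s c ⊆ K := by
      rw [segment_symm]; exact hdom s hs (segment_self_subset (h.subset hs))
    have hcp := hdom p hp.1 hsp'
    have hcv := hdom v hv hsv
    obtain ⟨l, hl⟩ := hex
    have l1 := hl p hp.1 hsp.symm hsp'
    have l2 := hl v hv hvs hsv
    have l3 := hl c hc hcg hcs
    have hcr' : cr (p - s) (v - s) ≠ 0 := by
      rw [← neg_sub s p, cr_neg_left]
      intro e
      rw [neg_eq_zero.1 e] at hcr
      simp at hcr
    obtain ⟨ξ, η, e⟩ := exists_coords hcr' (c - s)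
    have e' : cr l c - cr l s = ξ * (cr l p - cr l s) + η * (cr l v - cr l s) := by
      have := congrArg (cr l) e
      rw [sub_eq_add_neg c, sub_eq_add_neg p, sub_eq_add_neg v] at this
      simp only [cr_add_right, cr_mul_right, cr_neg_right] at this
      linarith
    have hvc : ∀ p q : ℝ, 0 ≤ p → 0 ≤ q → p + q ≤ 1 → s + p * (v - s) + q * (c - s) ∈ K :=
      fun p q h1 h2 h3 => h.holeFree.mem_of_corner hsv (by rwa [segment_symm]) hcs h1 h2 h3
    rcases le_or_gt η 0 with hη | hη
    · have hξ : 0 < ξ := by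
        by_contra! hn
        nlinarith [mul_nonneg_of_nonpos_of_nonpos hn (sub_neg.2 l1).le,
          mul_nonneg_of_nonpos_of_nonpos hη (sub_neg.2 l2).le]
      exact hblk.false_of_triangle hvc e hξ hη
    · obtain ⟨α, β, h1, h2, h3, h4, h5⟩ := (hblk.transfer hvc e hη) (1 / 2) (by norm_num)
      exact h5 (h.holeFree.mem_of_corner hsp' (by rwa [segment_symm]) hcs h1 h3 (by linarith))

/-- The points of `V` seen from the end `c` of the edge `[p, c]`, on the side given by `ε`, that lie
behind an obstacle at `c`. -/
def Behind (K V : Set ℂ) (p c : ℂ) (ε : ℝ) : Set ℂ :=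
  {g | g ∈ V ∧ segment ℝ c g ⊆ K ∧ 0 < ε * cr (c - p) (g - c) ∧ Blocked K c p g}

/-- A step of the pursuit: if `c` does not dominate the point `g` behind its obstacle, there is a
next edge `[c, s]` of the trail with an obstacle at `s`. The point `s` is a tangent point from `c`
for the path from `c` through `g` to a point `x` that `g` sees and `c` does not. -/
lemma Scene.exists_next {K V : Set ℂ} (h : Scene K V) {p c g x : ℂ} {ε : ℝ} (hc : c ∈ V)
    (hg : g ∈ Behind K V p c ε) (hx : x ∈ V) (hgx : segment ℝ g x ⊆ K)
    (hcx : ¬ segment ℝ c x ⊆ K) :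
    ∃ s ∈ V, segment ℝ c s ⊆ K ∧ Node K p c s ε ∧ ∃ ε' : ℝ, (Behind K V c s ε').Nonempty ∧
      (ε * cr (c - p) (s - c) < 0 → 0 < ε' * cr (c - p) (s - c)) := by
  obtain ⟨hgV, hcg, hε, hblk⟩ := hg
  obtain ⟨τ, hτ⟩ := exists_isLastSeen h.compact.isClosed hcg x
  have hτ1 : τ < 1 := hτ.2.1.lt_of_ne (by
    rintro rfl
    apply hcx
    simpa using hτ.2.2.1)
  obtain ⟨s, hs, v, hv, t, ht0, ht1, hst, hsc, -, hcs, hgs, hsv, hblk', hcr⟩ :=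
    h.exists_tangent hc hgV hx hcg hgx hτ hτ1
  have hE := cross_ne_zero_of_not_seen hcg hgx hcx
  have hd : s - c = (t * (1 - τ) : ℝ) * (g - c) + (t * τ : ℝ) * (x - c) := by
    rw [hst]; push_cast; ring
  have hcr0 : cr (c - p) (g - c) ≠ 0 := fun e => by rw [e] at hε; simp at hε
  have hcr0' : cr (p - c) (g - c) ≠ 0 := by rwa [← neg_sub c p, cr_neg_left, neg_ne_zero]
  obtain ⟨ξ, η, e⟩ := exists_coords hcr0' (s - c)
  have htri : ∀ p q : ℝ, 0 ≤ p → 0 ≤ q → p + q ≤ 1 → c + p * (g - c) + q * (s - c) ∈ K :=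
    fun p q h1 h2 h3 => h.holeFree.mem_of_corner hcg hgs hcs h1 h2 h3
  have hturn : cr (c - p) (s - c) = η * cr (c - p) (g - c) := by
    rw [e, cr_add_right, cr_mul_right, cr_mul_right, ← neg_sub c p, cr_neg_right, cr_self]; ring
  have hgs1 : cr (g - c) (s - c) = t * τ * cr (g - c) (x - c) := by
    rw [hd, cr_add_right, cr_mul_right, cr_mul_right, cr_self]; ring
  have hgs2 : cr (g - c) (s - c) = ξ * cr (c - p) (g - c) := by
    rw [e, cr_add_right, cr_mul_right, cr_mul_right, cr_self, cr_swap, ← neg_sub c p, cr_neg_left]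
    ring
  refine ⟨s, hs, hcs, ?_, cr (g - c) (x - c), ⟨v, hv, hsv, hcr, hblk'⟩, ?_⟩
  · rcases lt_or_ge 0 η with hη | hη
    · refine Or.inl ⟨hblk.transfer htri e hη, ?_⟩
      rw [hturn]
      nlinarith
    · rcases lt_trichotomy ξ 0 with hξ | hξ | hξ
      · exact Or.inr ⟨g, hblk, hε, ξ, η, hξ, hη, e⟩
      · -- the direction of `s` cannot be opposite to that of `g`
        exfalso
        rw [hξ, zero_mul, hgs1] at hgs2
        have hτ0 : τ = 0 := by
          have := (mul_eq_zero.1 hgs2).resolve_right hE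
          exact (mul_eq_zero.1 this).resolve_left ht0.ne'
        have hη' : η = t := by
          have h1 : cr (c - p) (s - c) = t * cr (c - p) (g - c) := by
            rw [hd, hτ0]; simp [cr_mul_right]
          rw [hturn] at h1
          exact mul_right_cancel₀ hcr0 h1
        linarith
      · exact (hblk.false_of_triangle htri e hξ hη).elim
  · intro hneg
    rw [hturn] at hneg ⊢
    have hη : η < 0 := by
      by_contra! hn
      have : ε * (η * cr (c - p) (g - c)) = η * (ε * cr (c - p) (g - c)) := by ring
      nlinarith [mul_nonneg hn hε.le]
    have hξ : ξ < 0 := by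
      by_contra! hn
      rcases hn.eq_or_lt with h0 | h0
      · rw [← h0, zero_mul, hgs1] at hgs2
        have hτ0 : τ = 0 := by
          have := (mul_eq_zero.1 hgs2).resolve_right hE
          exact (mul_eq_zero.1 this).resolve_left ht0.ne'
        have h1 : cr (c - p) (s - c) = t * cr (c - p) (g - c) := by
          rw [hd, hτ0]; simp [cr_mul_right]
        rw [hturn] at h1
        have := mul_right_cancel₀ hcr0 h1
        linarith
      · exact hblk.false_of_triangle htri e h0 hη.le
    -- both `ξ` and `η` are negative, so that the two cross products have the same sign
    set F := cr (c - p) (g - c)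
    set E := cr (g - c) (x - c)
    have h1 : 0 < t * τ * (E * E) := by
      have h2 : t * τ * (E * E) = ξ * F * E := by rw [← hgs2, hgs1]; ring
      have h3 : 0 ≤ t * τ * (E * E) := by
        have := hτ.1
        have := mul_self_nonneg E
        positivity
      refine h3.lt_of_ne fun h0 => ?_
      rw [h2] at h0
      rcases mul_eq_zero.1 h0.symm with h4 | h4
      · rcases mul_eq_zero.1 h4 with h5 | h5
        · exact hξ.ne h5
        · exact hcr0 h5
      · exact hE h4
    have h2 : t * τ * (E * E) = ξ * (E * F) := by
      have : t * τ * (E * E) = t * τ * E * E := by ring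
      rw [this, ← hgs1, hgs2]; ring
    rw [h2] at h1
    have h3 : E * F < 0 := by
      by_contra! hn
      nlinarith [mul_nonpos_of_nonpos_of_nonneg hξ.le hn]
    have h4 : E * (η * F) = η * (E * F) := by ring
    rw [h4]
    exact mul_pos_of_neg_of_neg hη h3

/-! ### Dominated points -/

lemma Trail.congr {K : Set ℂ} {c c' : ℕ → ℂ} {ε ε' : ℕ → ℝ} {n : ℕ} (h : Trail K c ε n)
    (hc : ∀ l ≤ n, c' l = c l) (hε : ∀ l ≤ n, ε' l = ε l) : Trail K c' ε' n where
  subset l hl := by rw [hc l (by omega), hc (l + 1) (by omega)]; exact h.subset l hl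
  simple l hl k hk := by
    rw [hc l (by omega), hc (l + 1) (by omega), hc k (by omega), hc (k + 1) (by omega)]
    exact h.simple l hl k hk
  node l hl := by
    rw [hc l (by omega), hc (l + 1) (by omega), hc (l + 2) (by omega), hε (l + 1) (by omega)]
    exact h.node l hl
  link l hl := by
    rw [hc l (by omega), hc (l + 1) (by omega), hc (l + 2) (by omega), hε (l + 1) (by omega),
      hε (l + 2) (by omega)]
    exact h.link l hl

lemma Trail.succ {K : Set ℂ} (hK : IsCompact K) (hH : HoleFree K) {c : ℕ → ℂ} {ε : ℕ → ℝ} {n : ℕ}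
    (h : Trail K c ε (n + 1)) (hs : segment ℝ (c (n + 1)) (c (n + 2)) ⊆ K)
    (hnode : Node K (c n) (c (n + 1)) (c (n + 2)) (ε (n + 1)))
    (hlink : ε (n + 1) * cr (c (n + 1) - c n) (c (n + 2) - c (n + 1)) < 0 →
      0 < ε (n + 2) * cr (c (n + 1) - c n) (c (n + 2) - c (n + 1))) : Trail K c ε (n + 2) where
  subset l hl := by
    rcases (Nat.lt_succ_iff.1 hl).eq_or_lt with rfl | hl
    · exact hs
    · exact h.subset l hl
  simple l hl k hk t ht ht1 := by
    rcases (Nat.lt_succ_iff.1 hl).eq_or_lt with rfl | hl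
    · exact h.not_mem_of_node hK hH hs hnode hk ht ht1
    · exact h.simple l hl k hk t ht ht1
  node l hl := by
    rcases (Nat.lt_succ_iff.1 hl).eq_or_lt with e | hl
    · obtain rfl : l = n := by omega
      exact hnode
    · exact h.node l hl
  link l hl := by
    rcases (Nat.lt_succ_iff.1 hl).eq_or_lt with e | hl
    · obtain rfl : l = n := by omega
      exact hlink
    · exact h.link l hl

/-- If `c` dominates all points behind its obstacle, one of them is exposed: an extreme one among
these points together with all points on the other side of the line `pc`. -/
lemma Scene.exists_exposed_behind {K V : Set ℂ} (h : Scene K V) {p c : ℂ} {ε : ℝ}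
    (hne : (Behind K V p c ε).Nonempty) (hdom : ∀ g ∈ Behind K V p c ε, SeesAllOf K V c g) :
    ∃ g ∈ Behind K V p c ε, Exposed K V g := by
  have hfin : (Behind K V p c ε ∪ {z | z ∈ V ∧ ε * cr (c - p) (z - c) ≤ 0}).Finite :=
    h.finite.subset (union_subset (fun z hz => hz.1) fun z hz => hz.1)
  have hcr : ∀ z, cr ((ε : ℂ) * (c - p)) z - cr ((ε : ℂ) * (c - p)) c = ε * cr (c - p) (z - c) :=
    fun z => by rw [cr_mul_left, cr_mul_left, sub_eq_add_neg z, cr_add_right, cr_neg_right]; ring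
  obtain ⟨g₀, hg₀⟩ := hne
  obtain ⟨g, hg, hθ, l, hl⟩ := exists_exposed hfin.toFinset (ε * (c - p)) (cr (ε * (c - p)) c)
    ⟨g₀, by simp [hg₀], by have := hcr g₀; have := hg₀.2.2.1; linarith⟩
  rw [Finite.mem_toFinset] at hg
  have hgpos : 0 < ε * cr (c - p) (g - c) := by have := hcr g; linarith
  have hgB : g ∈ Behind K V p c ε := hg.resolve_right fun h' => not_lt.2 h'.2 hgpos
  refine ⟨g, hgB, l, fun z hz hzg hgz => hl z ?_ hzg⟩
  rw [Finite.mem_toFinset]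
  rcases le_or_gt (ε * cr (c - p) (z - c)) 0 with hz0 | hz0
  · exact Or.inr ⟨hz, hz0⟩
  have hcz := hdom g hgB z hz hgz
  refine Or.inl ⟨hz, hcz, hz0, ?_⟩
  have hcr0 : cr (c - p) (g - c) ≠ 0 := fun e => by rw [e] at hgpos; simp at hgpos
  have hcr0' : cr (p - c) (g - c) ≠ 0 := by rwa [← neg_sub c p, cr_neg_left, neg_ne_zero]
  obtain ⟨ξ, η, e⟩ := exists_coords hcr0' (z - c)
  have hturn : cr (c - p) (z - c) = η * cr (c - p) (g - c) := by
    rw [e, cr_add_right, cr_mul_right, cr_mul_right, ← neg_sub c p, cr_neg_right, cr_self]; ring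
  refine hgB.2.2.2.transfer (fun p q h1 h2 h3 =>
    h.holeFree.mem_of_corner hgB.2.1 hgz hcz h1 h2 h3) e ?_
  rw [hturn] at hz0
  by_contra! hn
  have : ε * (η * cr (c - p) (g - c)) = η * (ε * cr (c - p) (g - c)) := by ring
  nlinarith

/-- In a scene with at least two points there is, besides any given point `r`, an exposed dominated
point. A pursuit starting at `r` that always moves to the next tangent point draws a trail that
does not meet itself, so it ends at a point `c` that dominates all points behind its obstacle. -/
lemma Scene.exists_dominated {K V : Set ℂ} (h : Scene K V) {r : ℂ} (hr : r ∈ V)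
    (h2 : ∃ z ∈ V, z ≠ r) :
    ∃ g ∈ V, g ≠ r ∧ Exposed K V g ∧ ∃ c ∈ V, c ≠ g ∧ SeesAllOf K V c g := by
  by_cases hall : ∀ z ∈ V, segment ℝ r z ⊆ K
  · obtain ⟨z, hz, hzr⟩ := h2
    obtain ⟨e, θ, he, -, hθ⟩ := exists_separating (x := r) (y := r) (z := z) (by simpa using hzr)
    obtain ⟨g, hg, hgθ, l, hl⟩ := exists_exposed h.finite.toFinset e θ ⟨z, by simpa using hz, hθ⟩
    have hgr : g ≠ r := by rintro rfl; linarith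
    exact ⟨g, by simpa using hg, hgr, ⟨l, fun z hz hzg _ => hl z (by simpa using hz) hzg⟩, r, hr,
      hgr.symm, fun z hz _ => hall z hz⟩
  by_contra! hno
  obtain ⟨q, hq, x, hx, hqx⟩ := h.conn {z | z ∈ V ∧ segment ℝ r z ⊆ K} (fun z hz => hz.1)
    ⟨r, hr, segment_self_subset (h.subset hr)⟩
    (fun e => hall fun z hz => ((Set.ext_iff.1 e z).2 hz).2)
  have hrx : ¬ segment ℝ r x ⊆ K := fun hrx => hx.2 ⟨hx.1, hrx⟩
  have key : ∀ n, ∃ c : ℕ → ℂ, ∃ ε : ℕ → ℝ, c 0 = r ∧ c 0 ≠ c 1 ∧ (∀ l ≤ n + 1, c l ∈ V) ∧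
      Trail K c ε (n + 1) ∧ (Behind K V (c n) (c (n + 1)) (ε (n + 1))).Nonempty := by
    intro n
    induction n with
    | zero =>
      obtain ⟨τ, hτ⟩ := exists_isLastSeen h.compact.isClosed hq.2 x
      have hτ1 : τ < 1 := hτ.2.1.lt_of_ne (by
        rintro rfl
        apply hrx
        simpa using hτ.2.2.1)
      obtain ⟨s, hs, v, hv, t, ht0, ht1, hst, hsr, -, hrs, hqs, hsv, hblk, hcr⟩ :=
        h.exists_tangent hr hq.1 hx.1 hq.2 hqx hτ hτ1
      refine ⟨fun l => if l = 0 then r else s, fun _ => cr (q - r) (x - r), by simp, ?_, ?_, ?_,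
        ⟨v, hv, ?_⟩⟩
      · simpa using hsr.symm
      · intro l _
        by_cases h0 : l = 0 <;> simp [h0, hr, hs]
      · exact
          { subset := fun l hl => by obtain rfl : l = 0 := by omega
                                     simpa using hrs
            simple := fun l hl k hk => by omega
            node := fun l hl => by omega
            link := fun l hl => by omega }
      · simpa using ⟨hsv, hcr, hblk⟩
    | succ n ih =>
      obtain ⟨c, ε, hc0, hc01, hcV, hT, hB⟩ := ih
      have hcn := hcV (n + 1) le_rfl
      by_cases hterm : ∀ g ∈ Behind K V (c n) (c (n + 1)) (ε (n + 1)), SeesAllOf K V (c (n + 1)) g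
      · -- the pursuit has ended
        exfalso
        obtain ⟨g, hg, hgE⟩ := h.exists_exposed_behind hB hterm
        have hgr : g ≠ r := by
          rintro rfl
          refine hT.not_mem_of_node h.compact h.holeFree hg.2.1 (Or.inl ⟨hg.2.2.2, hg.2.2.1⟩)
            (show 0 < n + 1 by omega) one_pos le_rfl ?_
          rw [ofReal_one, one_mul, add_sub_cancel, ← hc0]
          exact left_mem_segment ℝ _ _
        refine hno g hg.1 hgr hgE (c (n + 1)) hcn (fun e => ?_) (hterm g hg)
        have := hg.2.2.1
        rw [e, sub_self] at this
        simp [cr] at this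
      · unfold SeesAllOf at hterm
        push Not at hterm
        obtain ⟨g, hg, y, hy, hgy, hcy⟩ := hterm
        obtain ⟨s, hs, hcs, hnode, ε', hB', hlink⟩ := h.exists_next hcn hg hy hgy hcy
        let c' := Function.update c (n + 2) s
        let e' := Function.update ε (n + 2) ε'
        have hc' : ∀ l ≤ n + 1, c' l = c l := fun l hl => Function.update_of_ne (by omega) _ _
        have he' : ∀ l ≤ n + 1, e' l = ε l := fun l hl => Function.update_of_ne (by omega) _ _
        have hcs' : c' (n + 2) = s := Function.update_self _ _ _
        have hes' : e' (n + 2) = ε' := Function.update_self _ _ _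
        refine ⟨c', e', by rw [hc' 0 (by omega), hc0], by rwa [hc' 0 (by omega), hc' 1 (by omega)],
          fun l hl => ?_, ?_, ?_⟩
        · rcases hl.eq_or_lt with rfl | hl
          · exact hcs'.symm ▸ hs
          · rw [hc' l (by omega)]; exact hcV l (by omega)
        · refine (hT.congr hc' he').succ h.compact h.holeFree ?_ ?_ ?_
          · rwa [hc' _ le_rfl, hcs']
          · rwa [hc' _ le_rfl, hc' n (by omega), he' _ le_rfl, hcs']
          · rw [hc' _ le_rfl, hc' n (by omega), he' _ le_rfl, hcs', hes']
            exact hlink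
        · show (Behind K V (c' (n + 1)) (c' (n + 2)) (e' (n + 2))).Nonempty
          rwa [hc' _ le_rfl, hcs', hes']
  -- a trail with more vertices than `V` has points is impossible
  obtain ⟨c, ε, hc0, hc01, hcV, hT, -⟩ := key h.finite.toFinset.card
  set N := h.finite.toFinset.card
  have hinj : Set.InjOn c (Finset.range (N + 1)) := by
    have hlt : ∀ a b, a < b → b ≤ N → c a ≠ c b := by
      intro a b hab hb e
      obtain ⟨b, rfl⟩ := Nat.exists_eq_succ_of_ne_zero (show b ≠ 0 by omega)
      rcases (Nat.lt_succ_iff.1 hab).eq_or_lt with rfl | hab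
      · rcases Nat.eq_zero_or_pos a with rfl | ha
        · exact hc01 e
        · obtain ⟨a, rfl⟩ := Nat.exists_eq_succ_of_ne_zero ha.ne'
          refine hT.end_notMem (l := a + 1) (k := a) (by omega) (by omega) ?_
          rw [Nat.succ_eq_add_one] at e
          rw [← e]
          exact right_mem_segment ℝ _ _
      · refine hT.end_notMem (l := b) (k := a) (by omega) hab ?_
        rw [Nat.succ_eq_add_one] at e
        rw [← e]
        exact left_mem_segment ℝ _ _
    intro a ha b hb e
    simp only [Finset.coe_range, mem_Iio] at ha hb
    rcases lt_trichotomy a b with h' | h' | h'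
    · exact absurd e (hlt a b h' (by omega))
    · exact h'
    · exact absurd e.symm (hlt b a h' (by omega))
  have hcard := Finset.card_le_card_of_injOn (s := Finset.range (N + 1)) (t := h.finite.toFinset) c
    (fun l hl => by
      simp only [Finset.coe_range, mem_Iio] at hl
      simpa using hcV l (by omega)) hinj
  simp at hcard
  omega

lemma SeesAllOf.trans {K V : Set ℂ} {a b c : ℂ} (h1 : SeesAllOf K V a b) (h2 : SeesAllOf K V b c) :
    SeesAllOf K V a c := fun z hz h => h1 z hz (h2 z hz h)

/-- In a scene with at least three points, two points can be removed one after the other, both of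
them being dominated by other points. -/
lemma Scene.exists_two_dominated {K V : Set ℂ} (h : Scene K V) (h3 : 3 ≤ V.ncard) :
    ∃ a ∈ V, ∃ b ∈ V, a ≠ b ∧ (∃ c ∈ V, c ≠ a ∧ c ≠ b ∧ SeesAllOf K V c a) ∧
      (∃ c ∈ V, c ≠ a ∧ c ≠ b ∧ SeesAllOf K V c b) ∧ Scene K (V \ {a, b}) := by
  have hother : ∀ W : Set ℂ, W.Finite → 2 ≤ W.ncard → ∀ r, ∃ z ∈ W, z ≠ r := fun W hW hc r =>
    W.exists_ne_of_one_lt_ncard (by omega) r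
  obtain ⟨r, hr⟩ : V.Nonempty := by
    rw [← ncard_pos h.finite]; omega
  obtain ⟨a, ha, -, haE, a', ha', haa', hda⟩ :=
    h.exists_dominated hr (hother V h.finite (by omega) r)
  obtain ⟨b, hb, hba, hbE, b', hb', hbb', hdb⟩ :=
    h.exists_dominated ha (hother V h.finite (by omega) a)
  have hrem := h.remove ha ha' haa' hda haE
  have hset : ∀ b, (V \ {a}) \ {b} = V \ {a, b} := fun b => by
    rw [sdiff_sdiff, singleton_union]
  by_cases htwin : a' = b ∧ b' = a
  · -- `a` and `b` see the same points; then a third point is found in the scene without `a`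
    obtain ⟨rfl, rfl⟩ := htwin
    have hn : (V \ {b'}).ncard + 1 = V.ncard := ncard_sdiff_singleton_add_one ha h.finite
    obtain ⟨d, hd, hda', hdE, d', hd', hdd', hdd⟩ := hrem.exists_dominated (r := a') ⟨hb, hba⟩
      (hother _ hrem.finite (by omega) a')
    refine ⟨b', ha, d, hd.1, fun e => hd.2 e.symm, ⟨a', hb, hba, hda'.symm, hda⟩,
      ⟨d', hd'.1, hd'.2, hdd', fun z hz hdz => ?_⟩, ?_⟩
    · by_cases hzb : z = b'
      · subst hzb
        rw [segment_symm] at hdz ⊢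
        have := hdd a' ⟨hb, hba⟩ (by rw [segment_symm]; exact hda d hd.1 hdz)
        exact hdb d' hd'.1 (by rwa [segment_symm])
      · exact hdd z ⟨hz, hzb⟩ hdz
    · rw [← hset]
      exact hrem.remove hd hd' hdd' hdd hdE
  · -- dominating points outside `{a, b}`
    have h1 : ∃ c ∈ V, c ≠ a ∧ c ≠ b ∧ SeesAllOf K V c a := by
      by_cases e : a' = b
      · refine ⟨b', hb', fun e' => htwin ⟨e, e'⟩, hbb', ?_⟩
        exact hdb.trans (e ▸ hda)
      · exact ⟨a', ha', haa', e, hda⟩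
    have h2 : ∃ c ∈ V, c ≠ a ∧ c ≠ b ∧ SeesAllOf K V c b := by
      by_cases e : b' = a
      · refine ⟨a', ha', haa', fun e' => htwin ⟨e', e⟩, ?_⟩
        exact hda.trans (e ▸ hdb)
      · exact ⟨b', hb', e, hbb', hdb⟩
    refine ⟨a, ha, b, hb, hba.symm, h1, h2, ?_⟩
    obtain ⟨c, hc, hca, hcb, hd⟩ := h2
    rw [← hset]
    refine hrem.remove ⟨hb, hba⟩ ⟨hc, hca⟩ hcb (fun z hz => hd z hz.1) ?_
    obtain ⟨l, hl⟩ := hbE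
    exact ⟨l, fun z hz => hl z hz.1⟩

/-! ### Cops and robbers -/

universe u

lemma self_mem_closedNeighborSet {V : Type u} (G : SimpleGraph V) (v : V) :
    v ∈ G.closedNeighborSet v := mem_insert _ _

lemma mem_closedNeighborSet {V : Type u} {G : SimpleGraph V} {v w : V} :
    w ∈ G.closedNeighborSet v ↔ w = v ∨ G.Adj v w := Iff.rfl

lemma mem_closedNeighborSet_comm {V : Type u} {G : SimpleGraph V} {v w : V} :
    w ∈ G.closedNeighborSet v ↔ v ∈ G.closedNeighborSet w := by
  rw [mem_closedNeighborSet, mem_closedNeighborSet, G.adj_comm, eq_comm]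

/-- If every vertex is dominated by a vertex of `W`, the cop wins on `G` at most one move later
than on the subgraph induced by `W`: the cop plays on `W` against the shadow `ρ ∘ r` of the robber,
and once the shadow is caught, domination puts the robber within reach. -/
lemma copWinsWithin_succ_of_dominates {V : Type u} {G : SimpleGraph V} {W : Set V} (ρ : V → W)
    (hρ : ∀ v, G.Dominates (ρ v : V) v) {m : ℕ} (h : (G.induce W).CopWinsWithin m) :
    G.CopWinsWithin (m + 1) := by
  classical
  obtain ⟨σ, hσ⟩ := h
  have hval : ∀ {v w : W}, w ∈ (G.induce W).closedNeighborSet v ↔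
      (w : V) ∈ G.closedNeighborSet (v : V) := by
    intro v w
    simp [mem_closedNeighborSet, Subtype.ext_iff]
  let τ : G.CopStrategy :=
    { start := σ.start
      move := fun c r => if r ∈ G.closedNeighborSet c then r else
        if hc : c ∈ W then (σ.move ⟨c, hc⟩ (ρ r) : V) else c
      move_mem := fun c r => by
        by_cases h1 : r ∈ G.closedNeighborSet c
        · simp [h1]
        · by_cases h2 : c ∈ W
          · simpa [h1, h2] using hval.1 (σ.move_mem ⟨c, h2⟩ (ρ r))
          · simpa [h1, h2] using self_mem_closedNeighborSet G c }
  have hcatch : ∀ r k, r k ∈ G.closedNeighborSet (τ.position r k) → τ.CatchesAt r (k + 1) :=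
    fun r k hk => ⟨Nat.le_add_left 1 k, by
      change (if r k ∈ G.closedNeighborSet (τ.position r k) then r k else _) = r k
      rw [if_pos hk]⟩
  refine ⟨τ, fun r hr => ?_⟩
  obtain ⟨k, hkm, hk1, hk⟩ := hσ (fun l => ρ (r l)) fun l => by
    refine hval.2 (mem_closedNeighborSet_comm.1 (hρ _ (mem_closedNeighborSet_comm.1 (hρ _ ?_))))
    exact hr l
  by_contra! hno
  have hfar : ∀ l ≤ k, r l ∉ G.closedNeighborSet (τ.position r l) :=
    fun l hl hmem => hno (l + 1) (by omega) (hcatch r l hmem)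
  have hpos : ∀ l ≤ k, τ.position r l = σ.position (fun l => ρ (r l)) l := by
    intro l
    induction l with
    | zero => exact fun _ => rfl
    | succ l ih =>
      intro hl
      have e := ih (by omega)
      have hn := hfar l (by omega)
      change (if r l ∈ G.closedNeighborSet (τ.position r l) then r l else
        if hc : τ.position r l ∈ W then (σ.move ⟨τ.position r l, hc⟩ (ρ (r l)) : V)
          else τ.position r l) = (σ.move (σ.position (fun l => ρ (r l)) l) (ρ (r l)) : V)
      rw [if_neg hn]
      have hW : τ.position r l ∈ W := by rw [e]; exact Subtype.coe_prop _
      rw [dif_pos hW]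
      congr 2
      exact Subtype.ext e
  refine hfar k le_rfl ?_
  rw [hpos k le_rfl, hk]
  have := hr (k - 1)
  rw [Nat.sub_add_cancel hk1] at this
  exact hρ _ this

lemma copWinsWithin_one {V : Type u} {G : SimpleGraph V} (c : V)
    (hc : ∀ v, v ∈ G.closedNeighborSet c) : G.CopWinsWithin 1 := by
  classical
  refine ⟨⟨c, fun x r => if r ∈ G.closedNeighborSet x then r else x, fun x r => ?_⟩, fun r _ =>
    ⟨1, le_rfl, le_rfl, ?_⟩⟩
  · by_cases h : r ∈ G.closedNeighborSet x
    · simp [h]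
    · simpa [h] using self_mem_closedNeighborSet G x
  · change (if r 0 ∈ G.closedNeighborSet c then r 0 else c) = r 0
    rw [if_pos (hc _)]

lemma copWin_of_copWinsWithin {V : Type u} {G : SimpleGraph V} {m : ℕ} (h : G.CopWinsWithin m) :
    G.CopWin :=
  h.imp fun _ hσ r hr => (hσ r hr).imp fun _ hk => hk.2

/-- The visibility graph of a scene is 2-dismantlable, and each pair of dominated vertices removed
costs the cop one move. The maximum with `1` only matters for a single vertex, where the cop still
has to make a move to catch the robber. -/
lemma Scene.isTwoDismantlable {K : Set ℂ} (n : ℕ) : ∀ {V : Type u} [Finite V] (f : V → ℂ)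
    (_ : Function.Injective f) (G : SimpleGraph V)
    (_ : ∀ i j, G.Adj i j ↔ i ≠ j ∧ segment ℝ (f i) (f j) ⊆ K) (_ : Scene K (range f))
    (_ : Nat.card V = n) (_ : 0 < n),
    G.CopWinsWithin (max 1 (n / 2)) ∧ G.IsTwoDismantlable := by
  induction n using Nat.strong_induction_on with
  | _ n ih =>
    intro V _ f hf G hG hS hn hpos
    have hmem : ∀ i j, j ∈ G.closedNeighborSet i ↔ segment ℝ (f i) (f j) ⊆ K := by
      intro i j
      rw [mem_closedNeighborSet, hG]
      by_cases e : j = i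
      · simpa [e] using hS.subset (mem_range_self i)
      · simp [e, Ne.symm e]
    rcases (by omega : n = 1 ∨ n = 2 ∨ 3 ≤ n) with rfl | rfl | h3
    · obtain ⟨_, ⟨v⟩⟩ := Nat.card_eq_one_iff_unique.1 hn
      have h1 : G.CopWinsWithin 1 := copWinsWithin_one v fun w =>
        Subsingleton.elim v w ▸ self_mem_closedNeighborSet G v
      exact ⟨h1, .small G (by omega) (copWin_of_copWinsWithin h1)⟩
    · obtain ⟨v, w, hvw, huniv⟩ := Nat.card_eq_two_iff.1 hn
      have hor : ∀ x, x = v ∨ x = w := fun x => by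
        have : x ∈ ({v, w} : Set V) := huniv ▸ mem_univ x
        simpa using this
      have h1 : G.CopWinsWithin 1 := by
        obtain ⟨_, rfl, _, ⟨⟨y, rfl⟩, hy⟩, hs⟩ := hS.conn {f v} (by simp) (by simp) (fun e => by
          have : f w ∈ ({f v} : Set ℂ) := e ▸ mem_range_self w
          exact hvw (hf this).symm)
        have hyw : y = w := (hor y).resolve_left fun e => hy (e ▸ rfl)
        refine copWinsWithin_one v fun x => ?_
        rcases hor x with rfl | rfl
        · exact self_mem_closedNeighborSet G x
        · exact (hmem _ _).2 (hyw ▸ hs)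
      exact ⟨h1, .small G (by omega) (copWin_of_copWinsWithin h1)⟩
    · obtain ⟨_, ⟨a, rfl⟩, _, ⟨b, rfl⟩, hab, ⟨_, ⟨a', rfl⟩, ha'a, ha'b, ha⟩,
        ⟨_, ⟨b', rfl⟩, hb'a, hb'b, hb⟩, hS'⟩ := hS.exists_two_dominated (by
          rw [← image_univ, ncard_image_of_injective _ hf, ncard_univ]; omega)
      have hab : a ≠ b := ne_of_apply_ne f hab
      have ha'a := ne_of_apply_ne f ha'a
      have ha'b := ne_of_apply_ne f ha'b
      have hb'a := ne_of_apply_ne f hb'a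
      have hb'b := ne_of_apply_ne f hb'b
      have hda : G.Dominates a' a := fun z hz => (hmem _ _).2
        (ha _ (mem_range_self z) ((hmem _ _).1 hz))
      have hdb : G.Dominates b' b := fun z hz => (hmem _ _).2
        (hb _ (mem_range_self z) ((hmem _ _).1 hz))
      set W : Set V := {v | v ≠ a ∧ v ≠ b} with hW
      have hWc : W = {a, b}ᶜ := by ext v; simp [hW]
      have hcard : Nat.card W = n - 2 := by
        rw [Nat.card_coe_set_eq, hWc, ncard_compl, ncard_pair hab, hn]
      have hrange : range (fun v : W => f v) = range f \ {f a, f b} := by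
        rw [hWc, range_comp' f Subtype.val, Subtype.range_coe, compl_eq_univ_sdiff,
          image_sdiff hf, image_univ, image_pair]
      obtain ⟨hwin, hdis⟩ := ih (n - 2) (by omega) (fun v : W => f v)
        (hf.comp Subtype.val_injective) (G.induce W) (fun i j => by
          simp [hG, Subtype.ext_iff]) (hrange ▸ hS') hcard (by omega)
      have hcop : G.CopWinsWithin (max 1 (n / 2)) := by
        rcases h3.eq_or_lt with rfl | h4
        · have := (Nat.card_eq_one_iff_unique.1 hcard).1
          have hu : ∀ v, v ≠ a → v ≠ b → v = a' := fun v h1 h2 => congrArg Subtype.val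
            (Subsingleton.elim (⟨v, h1, h2⟩ : W) ⟨a', ha'a, ha'b⟩)
          refine copWinsWithin_one a' fun v => ?_
          by_cases h1 : v = a
          · exact h1 ▸ hda (self_mem_closedNeighborSet G a)
          by_cases h2 : v = b
          · rw [← hu b' hb'a hb'b]
            exact h2 ▸ hdb (self_mem_closedNeighborSet G b)
          · exact hu v h1 h2 ▸ self_mem_closedNeighborSet G v
        · classical
          have hm : max 1 (n / 2) = max 1 ((n - 2) / 2) + 1 := by omega
          rw [hm]
          refine copWinsWithin_succ_of_dominates (W := W) (fun v =>
            if h1 : v = a then ⟨a', ha'a, ha'b⟩ else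
            if h2 : v = b then ⟨b', hb'a, hb'b⟩ else ⟨v, h1, h2⟩) (fun v => ?_) hwin
          by_cases h1 : v = a
          · simpa [h1] using hda
          by_cases h2 : v = b
          · simpa [h2, hab.symm] using hdb
          · simp [h1, h2, SimpleGraph.Dominates]
      refine ⟨hcop, ?_⟩
      rcases lt_or_ge n 7 with h7 | h7
      · exact .small G (by omega) (copWin_of_copWinsWithin hcop)
      · exact .step G a b hab ⟨a', ha'a, ha'b, hda⟩ ⟨b', hb'a, hb'b, hdb⟩ hdis

/-! ### The region of a closed path -/

/-- A set together with the points that it encloses. -/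
def fill {E : Type*} [TopologicalSpace E] [Bornology E] (B : Set E) : Set E :=
  B ∪ {x | x ∉ B ∧ Bornology.IsBounded (connectedComponentIn Bᶜ x)}

lemma notMem_fill {E : Type*} [TopologicalSpace E] [Bornology E] {B : Set E} {o : E} :
    o ∉ fill B ↔ o ∉ B ∧ ¬ Bornology.IsBounded (connectedComponentIn Bᶜ o) := by
  simp only [fill, mem_union, mem_ofPred_eq, not_or, not_and]
  exact ⟨fun h => ⟨h.1, h.2 h.1⟩, fun h => ⟨h.1, fun _ => h.2⟩⟩

lemma notMem_fill_of_isPreconnected {E : Type*} [TopologicalSpace E] [Bornology E] {B C : Set E}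
    (hC : IsPreconnected C) (hCB : Disjoint C B) {o u : E} (ho : o ∈ C) (hu : u ∈ C)
    (hoK : o ∉ fill B) : u ∉ fill B := by
  have hsub := hC.subset_connectedComponentIn ho (subset_compl_iff_disjoint_right.2 hCB)
  rw [notMem_fill] at hoK ⊢
  exact ⟨disjoint_left.1 hCB hu, connectedComponentIn_eq (hsub hu) ▸ hoK.2⟩

lemma isClosed_fill {B : Set ℂ} (hB : IsClosed B) : IsClosed (fill B) := by
  rw [← isOpen_compl_iff, isOpen_iff_mem_nhds]
  intro o ho
  have hoB : o ∈ Bᶜ := (notMem_fill.1 ho).1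
  filter_upwards [hB.isOpen_compl.connectedComponentIn.mem_nhds (mem_connectedComponentIn hoB)]
    with u hu
  exact notMem_fill_of_isPreconnected isPreconnected_connectedComponentIn
    (subset_compl_iff_disjoint_right.1 (connectedComponentIn_subset _ _))
    (mem_connectedComponentIn hoB) hu ho

lemma isCompact_fill {B : Set ℂ} (hB : IsCompact B) : IsCompact (fill B) := by
  refine Metric.isCompact_of_isClosed_isBounded (isClosed_fill hB.isClosed) ?_
  obtain ⟨R, hR⟩ := hB.isBounded.subset_closedBall 0
  refine (Metric.isBounded_closedBall (x := (0 : ℂ)) (r := max R 1)).subset fun z hz => ?_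
  by_contra hzR
  rw [mem_closedBall_zero_iff, not_le, max_lt_iff] at hzR
  -- the ray from `z` away from the origin is unbounded and misses `B`
  have hray : IsPreconnected ((fun t : ℝ => (t : ℂ) * z) '' Ici 1) :=
    isPreconnected_Ici.image _ (by fun_prop)
  have hnorm : ∀ t : ℝ, 1 ≤ t → ‖(t : ℂ) * z‖ = t * ‖z‖ := fun t ht => by
    rw [norm_mul, norm_real, Real.norm_of_nonneg (by linarith)]
  have hdisj : (fun t : ℝ => (t : ℂ) * z) '' Ici 1 ⊆ Bᶜ := by
    rintro _ ⟨t, ht, rfl⟩ hmem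
    have := hR hmem
    rw [mem_closedBall_zero_iff, hnorm t ht] at this
    have ht : 1 ≤ t := ht
    nlinarith
  have hz1 : z ∈ (fun t : ℝ => (t : ℂ) * z) '' Ici 1 := ⟨1, by simp, by simp⟩
  refine notMem_fill.2 ⟨hdisj hz1, fun hb => ?_⟩ hz
  obtain ⟨M, hM⟩ := (hb.subset (hray.subset_connectedComponentIn hz1 hdisj)).subset_closedBall 0
  have := hM ⟨max M 1 + 1, by simp [mem_Ici], rfl⟩
  rw [mem_closedBall_zero_iff, hnorm _ (by linarith [le_max_right M 1])] at this
  nlinarith [le_max_left M 1, le_max_right M 1]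

lemma holeFree_fill (B : Set ℂ) : HoleFree (fill B) := by
  intro o ho hb
  have hoB := notMem_fill.1 ho
  refine hoB.2 (hb.subset (isPreconnected_connectedComponentIn.subset_connectedComponentIn
    (mem_connectedComponentIn hoB.1) fun u hu => ?_))
  exact notMem_fill_of_isPreconnected isPreconnected_connectedComponentIn
    (subset_compl_iff_disjoint_right.1 (connectedComponentIn_subset _ _))
    (mem_connectedComponentIn hoB.1) hu ho

/-- The union of the edges from `w i` to `w (nx i)`. -/
def closedPath {ι : Type*} (w : ι → ℂ) (nx : ι → ι) : Set ℂ :=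
  ⋃ i, segment ℝ (w i) (w (nx i))

lemma isCompact_closedPath {ι : Type*} [Finite ι] (w : ι → ℂ) (nx : ι → ι) :
    IsCompact (closedPath w nx) :=
  isCompact_iUnion fun _ => isCompact_segment _ _

/-- No point is visited twice when the edges, each without its final endpoint, are traversed. -/
def SimplePath {ι : Type*} (w : ι → ℂ) (nx : ι → ι) : Prop :=
  ∀ i j : ι, ∀ s ∈ Ico (0 : ℝ) 1, ∀ t ∈ Ico (0 : ℝ) 1,
    w i + s * (w (nx i) - w i) = w j + t * (w (nx j) - w j) → i = j ∧ s = t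

lemma SimplePath.edge_ne_zero {ι : Type*} {w : ι → ℂ} {nx : ι → ι} (h : SimplePath w nx) (i : ι) :
    w (nx i) - w i ≠ 0 := by
  intro e
  have := (h i i 0 (by simp) (1 / 2) (by norm_num) (by simp [e])).2
  norm_num at this

lemma SimplePath.injective {ι : Type*} {w : ι → ℂ} {nx : ι → ι} (h : SimplePath w nx) :
    Function.Injective w :=
  fun i j e => (h i j 0 (by simp) 0 (by simp) (by simpa using e)).1

lemma exists_mem_Ioo_of_mem_segment {x y z : ℂ} (hz : z ∈ segment ℝ x y) (hx : z ≠ x)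
    (hy : z ≠ y) : ∃ s ∈ Ioo (0 : ℝ) 1, z = x + s * (y - x) := by
  obtain ⟨s, h0, h1, rfl⟩ := mem_segment_iff.1 hz
  refine ⟨s, ⟨h0.lt_of_ne ?_, h1.lt_of_ne ?_⟩, rfl⟩
  · rintro rfl; simp at hx
  · rintro rfl; simp at hy

/-- Near a point of the region that is not a vertex, the outside is empty or consists of open
half-discs bounded by the line of an edge. -/
lemma SimplePath.exists_halfDisc {ι : Type*} [Finite ι] {w : ι → ℂ} {nx : ι → ι}
    (h : SimplePath w nx) {z : ℂ} (hzK : z ∈ fill (closedPath w nx)) (hzw : z ∉ range w) :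
    ∃ d : ℂ, ∃ ε > 0, ∀ o ∈ Metric.ball z ε, o ∉ fill (closedPath w nx) → cr d (o - z) ≠ 0 ∧
      ∀ u ∈ Metric.ball z ε, 0 < cr d (o - z) * cr d (u - z) → u ∉ fill (closedPath w nx) := by
  by_cases hzB : z ∈ closedPath w nx
  · obtain ⟨i, hi⟩ := mem_iUnion.1 hzB
    have hnv : ∀ j, z ≠ w j := fun j e => hzw ⟨j, e.symm⟩
    obtain ⟨s, hs, hzs⟩ := exists_mem_Ioo_of_mem_segment hi (hnv _) (hnv _)
    have huniq : ∀ j, z ∈ segment ℝ (w j) (w (nx j)) → j = i := by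
      intro j hj
      obtain ⟨t, ht, hzt⟩ := exists_mem_Ioo_of_mem_segment hj (hnv _) (hnv _)
      exact (h j i t ⟨ht.1.le, ht.2⟩ s ⟨hs.1.le, hs.2⟩ (hzt ▸ hzs)).1
    have hd := h.edge_ne_zero i
    set d := w (nx i) - w i with hd_def
    have hclosed : IsClosed (⋃ j : {j // j ≠ i}, segment ℝ (w j) (w (nx j))) :=
      (isCompact_iUnion fun _ => isCompact_segment _ _).isClosed
    have hz' : z ∈ (⋃ j : {j // j ≠ i}, segment ℝ (w j) (w (nx j)))ᶜ := by
      simp only [mem_compl_iff, mem_iUnion, not_exists]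
      exact fun j hj => j.2 (huniq j hj)
    obtain ⟨ε₀, hε₀, hball⟩ := Metric.isOpen_iff.1 hclosed.isOpen_compl z hz'
    have hdn : 0 < ‖d‖ := norm_pos_iff.2 hd
    have hεle : min ε₀ (min s (1 - s) * ‖d‖) ≤ ε₀ := min_le_left _ _
    refine ⟨d, min ε₀ (min s (1 - s) * ‖d‖), lt_min hε₀
      (mul_pos (lt_min hs.1 (by linarith [hs.2])) hdn), ?_⟩
    have hline : ∀ u ∈ Metric.ball z (min ε₀ (min s (1 - s) * ‖d‖)), cr d (u - z) = 0 →
        u ∈ closedPath w nx := by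
      intro u hu h0
      obtain ⟨t, ht⟩ := exists_real_mul_of_cr_eq_zero hd h0
      rw [mem_ball_iff_norm, ht, norm_mul, norm_real, Real.norm_eq_abs] at hu
      have h1 := lt_of_mul_lt_mul_right (hu.trans_le (min_le_right _ _)) hdn.le
      have h2 := abs_lt.1 (h1.trans_le (min_le_left _ _))
      have h3 := abs_lt.1 (h1.trans_le (min_le_right _ _))
      refine mem_iUnion.2 ⟨i, mem_segment_iff.2 ⟨s + t, by linarith, by linarith, ?_⟩⟩
      rw [← sub_add_cancel u z, ht, hzs, ← hd_def]; push_cast; ring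
    intro o ho hoK
    have h0 : cr d (o - z) ≠ 0 := fun e => hoK (Or.inl (hline o ho e))
    refine ⟨h0, fun u hu hou => ?_⟩
    have hconv : Convex ℝ (Metric.ball z (min ε₀ (min s (1 - s) * ‖d‖)) ∩
        {u | 0 < cr d (o - z) * cr d (u - z)}) := by
      refine (convex_ball _ _).inter ?_
      intro a ha b hb α β hα hβ hαβ
      have e : cr d (α • a + β • b - z) = α * cr d (a - z) + β * cr d (b - z) := by
        rw [← cr_mul_right, ← cr_mul_right, ← cr_add_right]
        congr 1
        have hβ' : (β : ℂ) = 1 - α := by exact_mod_cast (show β = 1 - α by linarith)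
        rw [real_smul, real_smul, hβ']; ring
      rw [mem_ofPred_eq] at ha hb ⊢
      rw [e]
      have : cr d (o - z) * (α * cr d (a - z) + β * cr d (b - z)) =
        α * (cr d (o - z) * cr d (a - z)) + β * (cr d (o - z) * cr d (b - z)) := by ring
      rw [this]
      rcases hα.eq_or_lt with rfl | hα'
      · have : β = 1 := by linarith
        simpa [this] using hb
      · have := mul_pos hα' ha
        have := mul_nonneg hβ hb.le
        linarith
    refine notMem_fill_of_isPreconnected hconv.isPreconnected ?_ ⟨ho, mul_self_pos.2 h0⟩
      ⟨hu, hou⟩ hoK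
    rw [disjoint_left]
    rintro v ⟨hv, hov⟩ hvB
    obtain ⟨j, hj⟩ := mem_iUnion.1 hvB
    by_cases hji : j = i
    · subst hji
      obtain ⟨t, -, -, rfl⟩ := mem_segment_iff.1 hj
      rw [mem_ofPred_eq, hzs, show w j + t * (w (nx j) - w j) - (w j + s * (w (nx j) - w j))
        = ((t - s : ℝ) : ℂ) * (w (nx j) - w j) by push_cast; ring, cr_mul_right, ← hd_def,
        cr_self] at hov
      simp at hov
    · exact hball (Metric.ball_subset_ball hεle hv) (mem_iUnion.2 ⟨⟨j, hji⟩, hj⟩)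
  · obtain ⟨ε, hε, hball⟩ := Metric.isOpen_iff.1
      (isCompact_closedPath w nx).isClosed.isOpen_compl z hzB
    refine ⟨1, ε, hε, fun o ho hoK => absurd hzK ?_⟩
    exact notMem_fill_of_isPreconnected (convex_ball z ε).isPreconnected
      (subset_compl_iff_disjoint_right.1 hball) ho (Metric.mem_ball_self hε) hoK

/-- When the line of sight `[p, y]` is swept towards `x`, the points close to `p` avoid all edges:
an edge through `p` has a single direction, which the sweep does not meet at first. -/
lemma SimplePath.eventually_notMem {ι : Type*} [Finite ι] {w : ι → ℂ} {nx : ι → ι}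
    (h : SimplePath w nx) {p y x : ℂ} (hcr : cr (y - p) (x - y) ≠ 0) :
    ∀ᶠ z : ℝ × ℝ in 𝓝[>] (0 : ℝ) ×ˢ 𝓝[>] (0 : ℝ),
      p + z.1 * (y + z.2 * (x - y) - p) ∉ closedPath w nx := by
  simp only [closedPath, mem_iUnion, not_exists]
  refine Filter.eventually_all.2 fun i => ?_
  by_cases hp : p ∈ segment ℝ (w i) (w (nx i))
  · set d := w (nx i) - w i with hd_def
    have hd := h.edge_ne_zero i
    have hne : ∀ᶠ σ : ℝ in 𝓝[>] (0 : ℝ), cr d (y - p) + σ * cr d (x - y) ≠ 0 := by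
      by_cases h0 : cr d (y - p) = 0
      · filter_upwards [self_mem_nhdsWithin] with σ hσ
        rw [h0, zero_add]
        refine mul_ne_zero (ne_of_gt hσ) fun h1 => hcr ?_
        obtain ⟨a, ha⟩ := exists_real_mul_of_cr_eq_zero hd h0
        obtain ⟨b, hb⟩ := exists_real_mul_of_cr_eq_zero hd h1
        rw [ha, hb, cr_mul_left, cr_mul_right, cr_self]; ring
      · have : ContinuousAt (fun σ : ℝ => cr d (y - p) + σ * cr d (x - y)) 0 := by fun_prop
        exact (this.eventually_ne (by simpa using h0)).filter_mono nhdsWithin_le_nhds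
    have hpos : ∀ᶠ a : ℝ in 𝓝[>] (0 : ℝ), 0 < a := self_mem_nhdsWithin
    filter_upwards [hpos.prod_inl _, hne.prod_inr _] with z hz1 hz2 hmem
    obtain ⟨s, -, -, hs⟩ := mem_segment_iff.1 hp
    obtain ⟨t, -, -, ht⟩ := mem_segment_iff.1 hmem
    have e : (z.1 : ℂ) * (y - p + z.2 * (x - y)) = ((t - s : ℝ) : ℂ) * d := by
      push_cast; linear_combination ht - hs
    have e2 := congrArg (cr d) e
    rw [cr_mul_right, cr_mul_right, cr_self, mul_zero, cr_add_right, cr_mul_right] at e2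
    exact mul_ne_zero (ne_of_gt hz1) hz2 e2
  · have hc : ContinuousAt (fun z : ℝ × ℝ => p + (z.1 : ℂ) * (y + z.2 * (x - y) - p)) (0, 0) := by
      fun_prop
    have hev := hc.eventually_mem
      ((isCompact_segment (w i) (w (nx i))).isClosed.isOpen_compl.mem_nhds (by simpa using hp))
    rw [nhds_prod_eq] at hev
    exact hev.filter_mono (Filter.prod_mono nhdsWithin_le_nhds nhdsWithin_le_nhds)

/-! ### Lines of sight in a polygon -/

/-- Lines of sight in a polygon get stuck at vertices. The points outside the polygon on the swept
lines of sight accumulate on the last free one, and the accumulation point farthest from `p` must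
be a vertex: at an accumulation point inside an edge, the half-disc outside would either produce
farther ones or cut off a visible segment. -/
lemma SimplePath.tangent {ι : Type*} [Finite ι] {w : ι → ℂ} {nx : ι → ι} (h : SimplePath w nx)
    {p q x : ℂ} (hq : q ∈ range w)
    (hpq : segment ℝ p q ⊆ fill (closedPath w nx)) (hqx : segment ℝ q x ⊆ fill (closedPath w nx))
    {τ : ℝ} (hτ : IsLastSeen (fill (closedPath w nx)) p q x τ) (hτ1 : τ < 1) :
    ∃ s ∈ range w, s ≠ p ∧ s ∈ segment ℝ p (q + τ * (x - q)) ∧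
      Touched (fill (closedPath w nx)) p (q + τ * (x - q)) x s := by
  set K := fill (closedPath w nx) with hK
  obtain ⟨hτ0, -, hpy, hbad⟩ := hτ
  have hpx : ¬ segment ℝ p x ⊆ K := by simpa using hbad 1 hτ1 le_rfl
  have hcr := cross_ne_zero_of_not_seen hpq hqx hpx
  obtain ⟨y, hy⟩ : ∃ y, y = q + τ * (x - q) := ⟨_, rfl⟩
  have hyx : x - y = ((1 - τ : ℝ) : ℂ) * (x - q) := by rw [hy]; push_cast; ring
  have hcry : cr (y - p) (x - y) ≠ 0 := by
    have e1 : y - p = (q - p) + τ * (x - q) := by rw [hy]; ring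
    have e2 : x - q = (x - p) + -(q - p) := by ring
    have : cr (y - p) (x - y) = (1 - τ) * cr (q - p) (x - p) := by
      rw [hyx, cr_mul_right, e1, cr_add_left, cr_mul_left, cr_self, e2,
        cr_add_right, cr_neg_right, cr_self]; ring
    rw [this]
    exact mul_ne_zero (by linarith) hcr
  rw [← hy] at hpy ⊢
  have hyp : y ≠ p := by rintro rfl; simp [cr] at hcry
  obtain ⟨G, hG⟩ : ∃ G : ℝ × ℝ → ℂ, G = fun z => p + z.1 * (y + z.2 * (x - y) - p) := ⟨_, rfl⟩
  have hGc : Continuous G := by rw [hG]; fun_prop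
  -- a point of `A` is a point outside the polygon on a line of sight beyond the last free one
  let A : Set (ℝ × ℝ) := {z | z.1 ∈ Icc (0 : ℝ) 1 ∧ 0 < z.2 ∧ G z ∉ K}
  have hA1 : ∀ z ∈ closure A, z.1 ∈ Icc (0 : ℝ) 1 := fun z hz =>
    closure_minimal (fun _ hz => hz.1) (isClosed_Icc.preimage continuous_fst) hz
  have hAσ : ∀ σ ∈ Ioc (0 : ℝ) 1, ∃ l, (l, σ) ∈ A := by
    intro σ hσ
    obtain ⟨z, hz, hzK⟩ := not_subset.1 (hbad (τ + σ * (1 - τ)) (by nlinarith [hσ.1])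
      (by nlinarith [hσ.2]))
    obtain ⟨l, hl0, hl1, rfl⟩ := mem_segment_iff.1 hz
    refine ⟨l, ⟨hl0, hl1⟩, hσ.1, ?_⟩
    rw [show G (l, σ) = p + l * (q + ((τ + σ * (1 - τ) : ℝ) : ℂ) * (x - q) - p) by
      simp only [hG, hy]; push_cast; ring]
    exact hzK
  have hne : ∃ l, (l, (0 : ℝ)) ∈ closure A := by
    have hcomp : IsCompact (Prod.snd '' (closure A ∩ Icc (0 : ℝ) 1 ×ˢ Icc (0 : ℝ) 1)) :=
      ((isCompact_Icc.prod isCompact_Icc).inter_left isClosed_closure).image continuous_snd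
    have hsub : Ioc (0 : ℝ) 1 ⊆ Prod.snd '' (closure A ∩ Icc (0 : ℝ) 1 ×ˢ Icc (0 : ℝ) 1) := by
      intro σ hσ
      obtain ⟨l, hl⟩ := hAσ σ hσ
      exact ⟨(l, σ), ⟨subset_closure hl, hl.1, hσ.1.le, hσ.2⟩, rfl⟩
    have h0 : (0 : ℝ) ∈ closure (Ioc (0 : ℝ) 1) := by
      rw [closure_Ioc zero_ne_one]; exact ⟨le_rfl, zero_le_one⟩
    obtain ⟨⟨l, _⟩, hl, rfl⟩ := closure_minimal hsub hcomp.isClosed h0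
    exact ⟨l, hl.1⟩
  obtain ⟨l, hl, hmax⟩ : ∃ l, IsGreatest {l | (l, (0 : ℝ)) ∈ closure A} l := by
    refine IsCompact.exists_isGreatest (isCompact_Icc.of_isClosed_subset
      (isClosed_closure.preimage (by fun_prop)) fun l hl => hA1 _ hl) hne
  have hl : (l, (0 : ℝ)) ∈ closure A := hl
  obtain ⟨hl0, hl1⟩ : 0 ≤ l ∧ l ≤ 1 := hA1 _ hl
  have hG0 : ∀ l : ℝ, G (l, 0) = p + l * (y - p) := fun l => by simp [hG]
  have hzseg : G (l, 0) ∈ segment ℝ p y := mem_segment_iff.2 ⟨l, hl0, hl1, hG0 l⟩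
  have hAprod : ∀ {P : ℝ × ℝ → Prop}, (∀ᶠ z in 𝓝 (l, (0 : ℝ)), P z) → ∃ z ∈ A, P z := by
    intro P hP
    obtain ⟨z, hz, hzA⟩ := mem_closure_iff_nhds.1 hl _ hP
    exact ⟨z, hzA, hz⟩
  -- near `p` the sweep meets no edges, so if there are outside points arbitrarily near `p`, then
  -- all swept points up to some distance from `p` are outside
  have hlpos : 0 < l := by
    refine hl0.lt_of_ne fun hl0 => ?_
    subst hl0
    obtain ⟨P1, hP1, P2, hP2, hP⟩ := Filter.eventually_prod_iff.1 (h.eventually_notMem hcry)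
    obtain ⟨δ₁, hδ₁, hd1⟩ := mem_nhdsGT_iff_exists_Ioo_subset.1 hP1
    obtain ⟨δ₂, hδ₂, hd2⟩ := mem_nhdsGT_iff_exists_Ioo_subset.1 hP2
    have hδ₁ : 0 < δ₁ := hδ₁
    have hδ₂ : 0 < δ₂ := hδ₂
    obtain ⟨z, hzA, hz⟩ := hAprod ((isOpen_Iio.prod isOpen_Iio).mem_nhds
      (show ((0 : ℝ), (0 : ℝ)) ∈ Iio δ₁ ×ˢ Iio δ₂ from ⟨hδ₁, hδ₂⟩))
    have hz0 : 0 < z.1 := by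
      refine hzA.1.1.lt_of_ne fun e => hzA.2.2 ?_
      have : G z = p := by simp [hG, ← e]
      rw [this]
      exact hpy (left_mem_segment ℝ p y)
    have hpre : IsPreconnected (G '' (Ioo 0 δ₁ ×ˢ Ioo 0 δ₂)) :=
      (isPreconnected_Ioo.prod isPreconnected_Ioo).image _ hGc.continuousOn
    have hdisj : Disjoint (G '' (Ioo 0 δ₁ ×ˢ Ioo 0 δ₂)) (closedPath w nx) := by
      rw [disjoint_left]
      rintro _ ⟨u, hu, rfl⟩
      have := hP (hd1 hu.1) (hd2 hu.2)
      simpa only [hG] using this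
    have hlt : (0 : ℝ) < min (δ₁ / 2) 1 := by positivity
    refine absurd (hmax (show min (δ₁ / 2) 1 ∈ _ from ?_)) (not_le.2 hlt)
    refine mem_closure_of_tendsto (b := 𝓝[>] (0 : ℝ)) (f := fun σ => (min (δ₁ / 2) 1, σ))
      ((Continuous.tendsto' (by fun_prop) _ _ rfl).mono_left nhdsWithin_le_nhds) ?_
    filter_upwards [Ioo_mem_nhdsGT hδ₂] with σ hσ
    refine ⟨⟨hlt.le, min_le_right _ _⟩, hσ.1, ?_⟩
    exact notMem_fill_of_isPreconnected hpre hdisj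
      (mem_image_of_mem G ⟨⟨hz0, hz.1⟩, hzA.2.1, hz.2⟩)
      (mem_image_of_mem G ⟨⟨hlt, by linarith [min_le_left (δ₁ / 2) 1]⟩, hσ⟩) hzA.2.2
  refine ⟨G (l, 0), ?_, ?_, hzseg, ?_⟩
  · by_contra hnv
    obtain ⟨d, ε, hε, hd⟩ := h.exists_halfDisc (hpy hzseg) hnv
    have hball : ∀ᶠ z in 𝓝 (l, (0 : ℝ)), G z ∈ Metric.ball (G (l, 0)) ε :=
      hGc.continuousAt.eventually_mem (Metric.ball_mem_nhds _ hε)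
    obtain ⟨o, hoA, ho⟩ := hAprod hball
    obtain ⟨hne0, hhalf⟩ := hd _ ho hoA.2.2
    obtain ⟨f, hf⟩ : ∃ f : ℂ → ℝ, f = fun u => cr d (G o - G (l, 0)) * cr d (u - G (l, 0)) :=
      ⟨_, rfl⟩
    have hhalf : ∀ u ∈ Metric.ball (G (l, 0)) ε, 0 < f u → u ∉ K := by rw [hf]; exact hhalf
    have hfo : 0 < f (G o) := by rw [hf]; exact mul_self_pos.2 hne0
    have hfz : f (G (l, 0)) = 0 := by simp [hf, cr]
    have hflin : ∀ (a b : ℂ) (t : ℝ), f (a + t * (b - a)) = f a + t * (f b - f a) := by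
      intro a b t
      have : a + t * (b - a) - G (l, 0) =
          (a - G (l, 0)) + t * ((b - G (l, 0)) + -(a - G (l, 0))) := by ring
      simp only [hf]
      rw [this, cr_add_right, cr_mul_right, cr_add_right, cr_neg_right]; ring
    have hside : ∀ u, segment ℝ (G (l, 0)) u ⊆ K → f u ≤ 0 := by
      intro u hu
      by_contra! hpos
      have hc : Continuous fun t : ℝ => G (l, 0) + t * (u - G (l, 0)) := by fun_prop
      have hev : ∀ᶠ t : ℝ in 𝓝[>] 0, G (l, 0) + t * (u - G (l, 0)) ∈ Metric.ball (G (l, 0)) ε :=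
        (hc.continuousAt.eventually_mem (by simpa using Metric.ball_mem_nhds _ hε)).filter_mono
          nhdsWithin_le_nhds
      obtain ⟨t, htb, ht⟩ := (hev.and (Ioo_mem_nhdsGT (zero_lt_one' ℝ))).exists
      refine hhalf _ htb ?_ (hu (mem_segment_iff.2 ⟨t, ht.1.le, ht.2.le, rfl⟩))
      have := hflin (G (l, 0)) u t
      rw [hfz, zero_add, sub_zero] at this
      rw [this]
      exact mul_pos ht.1 hpos
    have hfG : ∀ z : ℝ × ℝ, f (G z) = f p + z.1 * (f y + z.2 * (f x - f y) - f p) := by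
      intro z
      rw [hG]
      simp only
      rw [hflin p, ← hflin y]
    have hfp : f p ≤ 0 := hside p (((convex_segment p y).segment_subset hzseg
      (left_mem_segment ℝ p y)).trans hpy)
    have hfy : f y ≤ 0 := hside y (((convex_segment p y).segment_subset hzseg
      (right_mem_segment ℝ p y)).trans hpy)
    have hfz' := hfG (l, 0)
    rw [hfz] at hfz'
    simp only [zero_mul, add_zero] at hfz'
    rw [hfG] at hfo
    rcases hl1.lt_or_eq with hl1 | rfl
    · -- the edge lies on the line of `p` and `y`, and the half-disc is on the side of `x`
      have hfp0 : f p = 0 := by nlinarith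
      have hfy0 : f y = 0 := by nlinarith
      rw [hfp0, hfy0] at hfo
      have hfx : 0 < f x := by
        have h1 : 0 < (o.1 * o.2) * f x := by linarith
        exact pos_of_mul_pos_right h1 (mul_nonneg hoA.1.1 hoA.2.1.le)
      rw [nhds_prod_eq] at hball
      obtain ⟨P1, hP1, P2, hP2, hP⟩ := Filter.eventually_prod_iff.1 hball
      obtain ⟨m, hm1, hm⟩ := ((hP1.filter_mono nhdsWithin_le_nhds).and (Ioo_mem_nhdsGT hl1)).exists
      refine absurd (hmax (show m ∈ _ from ?_)) (not_le.2 hm.1)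
      refine mem_closure_of_tendsto (b := 𝓝[>] (0 : ℝ)) (f := fun σ => (m, σ))
        ((Continuous.tendsto' (by fun_prop) _ _ rfl).mono_left nhdsWithin_le_nhds) ?_
      filter_upwards [hP2.filter_mono nhdsWithin_le_nhds, self_mem_nhdsWithin] with σ h2 hσ
      have hσ : 0 < σ := hσ
      refine ⟨⟨by linarith [hm.1], hm.2.le⟩, hσ, hhalf _ (hP hm1 h2) ?_⟩
      rw [hfG, hfp0, hfy0]
      have := mul_pos (mul_pos (hlpos.trans hm.1) hσ) hfx
      linarith
    · -- the edge lies on the line of `q` and `x`, and the half-disc is not on the side of `p`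
      have hzy : G (1, 0) = y := by rw [hG0]; push_cast; ring
      have hτpos : 0 < τ := by
        refine hτ0.lt_of_ne fun e => hnv ?_
        rw [hzy, hy, ← e]
        simpa using hq
      have hyqx : y ∈ segment ℝ q x := mem_segment_iff.2 ⟨τ, hτ0, hτ1.le, hy⟩
      have hfq : f q ≤ 0 := hside q (((convex_segment q x).segment_subset (hzy ▸ hyqx)
        (left_mem_segment ℝ q x)).trans hqx)
      have hfx : f x ≤ 0 := hside x (((convex_segment q x).segment_subset (hzy ▸ hyqx)
        (right_mem_segment ℝ q x)).trans hqx)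
      have hfy0 : f y = 0 := by rw [← hzy]; exact hfz
      have := hflin q x τ
      rw [← hy, hfy0] at this
      have hfx0 : f x = 0 := by nlinarith
      rw [hfx0, hfy0] at hfo
      nlinarith [hoA.1.2]
  · rw [hG0]
    intro e
    have : (l : ℂ) * (y - p) = 0 := by linear_combination e
    rcases mul_eq_zero.1 this with h0 | h0
    · exact hlpos.ne' (by exact_mod_cast h0)
    · exact hyp (sub_eq_zero.1 h0)
  · intro δ hδ
    obtain ⟨o, hoA, ho, ho1⟩ := hAprod ((hGc.continuousAt.eventually_mem
      (Metric.ball_mem_nhds (G (l, 0)) hδ)).and ((isOpen_Iio.preimage continuous_snd).mem_nhds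
        (show (l, (0 : ℝ)) ∈ Prod.snd ⁻¹' Iio (1 : ℝ) from zero_lt_one' ℝ)))
    have ho1 : o.2 < 1 := ho1
    have e : p + ((o.1 * (1 - o.2) : ℝ) : ℂ) * (y - p) + ((o.1 * o.2 : ℝ) : ℂ) * (x - p) = G o := by
      rw [hG]; push_cast; ring
    refine ⟨o.1 * (1 - o.2), o.1 * o.2, mul_nonneg hoA.1.1 (by linarith),
      mul_nonneg hoA.1.1 hoA.2.1.le, by linarith [hoA.1.2], ?_, ?_⟩
    · rw [e, ← mem_ball_iff_norm]; exact ho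
    · rw [e]; exact hoA.2.2

/-- The vertices of a polygon form a scene. -/
lemma SimplePath.scene {ι : Type*} [Finite ι] {w : ι → ℂ} {nx : ι → ι} (h : SimplePath w nx)
    (hconn : ∀ S : Set ι, S.Nonempty → S ≠ univ → ∃ i ∈ S, nx i ∉ S) :
    Scene (fill (closedPath w nx)) (range w) where
  compact := isCompact_fill (isCompact_closedPath w nx)
  holeFree := holeFree_fill _
  finite := finite_range w
  subset := by
    rintro _ ⟨i, rfl⟩
    exact Or.inl (mem_iUnion.2 ⟨i, left_mem_segment ℝ _ _⟩)
  conn S hS hne hSV := by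
    obtain ⟨i, hi, hni⟩ := hconn (w ⁻¹' S) (by
        obtain ⟨s, hs⟩ := hne
        obtain ⟨i, rfl⟩ := hS hs
        exact ⟨i, hs⟩) (fun e => hSV (hS.antisymm (by
          rintro _ ⟨i, rfl⟩
          have : i ∈ w ⁻¹' S := e ▸ mem_univ i
          exact this)))
    exact ⟨w i, hi, w (nx i), ⟨mem_range_self _, hni⟩, fun z hz => Or.inl (mem_iUnion.2 ⟨i, hz⟩)⟩
  tangent _ _ _ hq _ _ hpq hqx _ hτ hτ1 := h.tangent hq hpq hqx hτ hτ1

lemma image_fill {E F : Type*} [NormedAddCommGroup E] [NormedSpace ℝ E] [NormedAddCommGroup F]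
    [NormedSpace ℝ F] (e : E ≃ₗᵢ[ℝ] F) (B : Set E) : e '' fill B = fill (e '' B) := by
  ext y
  obtain ⟨x, rfl⟩ := e.surjective y
  rw [e.injective.mem_set_image, ← not_iff_not, notMem_fill, notMem_fill,
    e.injective.mem_set_image]
  refine and_congr_right fun hx => not_congr ?_
  have h1 := e.toHomeomorph.image_connectedComponentIn (s := Bᶜ) hx
  rw [image_compl_eq e.toHomeomorph.bijective] at h1
  change e '' _ = connectedComponentIn (e '' B)ᶜ (e x) at h1
  rw [← h1]
  refine ⟨fun hb => e.lipschitz.isBounded_image hb, fun hb => ?_⟩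
  have := e.symm.lipschitz.isBounded_image hb
  rwa [← image_comp, show (e.symm ∘ e : E → E) = id from funext e.symm_apply_apply, image_id]
    at this

lemma exists_finRotate_notMem {n : ℕ} (hn : 2 ≤ n) {S : Set (Fin n)} (hne : S.Nonempty)
    (hS : S ≠ univ) : ∃ i ∈ S, finRotate n i ∉ S := by
  by_contra! hno
  obtain ⟨i, hi⟩ := hne
  refine hS (eq_univ_of_forall fun j => ?_)
  have hmove : ∀ k, finRotate n k ≠ k := fun k => by
    rw [← Equiv.Perm.mem_support, support_finRotate_of_le hn]; exact Finset.mem_univ k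
  obtain ⟨k, rfl⟩ := (isCycle_finRotate_of_le hn).exists_pow_eq (hmove i) (hmove j)
  clear hmove hS
  induction k with
  | zero => simpa using hi
  | succ k ih => rw [pow_succ', Equiv.Perm.mul_apply]; exact hno _ ih

end PolygonVisibility


theorem mainTheorem1 {n : ℕ} (P : Polygon (EuclideanSpace ℝ (Fin 2)) n) (hP : P.IsSimple) :
    P.visibilityGraph.IsTwoDismantlable ∧
      ∃ m : ℕ, (m : ℝ) ≤ (n : ℝ) / 2 ∧ P.visibilityGraph.CopWinsWithin m := by
  obtain ⟨h3, hinj⟩ := hP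
  -- identify the plane with `ℂ`
  let e : EuclideanSpace ℝ (Fin 2) ≃ₗᵢ[ℝ] ℂ := Complex.orthonormalBasisOneI.repr.symm
  let w : Fin n → ℂ := fun i => e (P i)
  have hedge : ∀ x y : EuclideanSpace ℝ (Fin 2), e '' segment ℝ x y = segment ℝ (e x) (e y) :=
    fun x y => image_segment ℝ e.toLinearEquiv.toLinearMap.toAffineMap x y
  have hw : PolygonVisibility.SimplePath w (finRotate n) := by
    intro i j s hs t ht heq
    refine hinj i j s hs t ht (e.injective ?_)
    have hpath : ∀ (k : Fin n) (r : ℝ), e (P.edgePath ℝ k r) =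
        w k + r * (w (finRotate n k) - w k) := by
      intro k r
      simp [Polygon.edgePath, AffineMap.lineMap_apply, w, add_comm]
    rw [hpath, hpath, heq]
  have hB : e '' P.boundary ℝ = PolygonVisibility.closedPath w (finRotate n) := by
    rw [Polygon.boundary, Set.image_iUnion, PolygonVisibility.closedPath]
    refine Set.iUnion_congr fun i => ?_
    rw [Polygon.edgeSet, affineSegment_eq_segment, hedge]
  have hregion : e '' P.region = PolygonVisibility.fill (PolygonVisibility.closedPath w
      (finRotate n)) := by
    rw [← hB, ← PolygonVisibility.image_fill]; rfl
  obtain ⟨hwin, hdis⟩ := PolygonVisibility.Scene.isTwoDismantlable n w hw.injective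
    P.visibilityGraph (fun i j => by
      change _ ∧ segment ℝ (P i) (P j) ⊆ P.region ↔ _
      rw [← hregion, ← hedge, Set.image_subset_image_iff e.injective])
    (hw.scene fun S hne hS => PolygonVisibility.exists_finRotate_notMem (by omega) hne hS)
    (by simp) (by omega)
  refine ⟨hdis, n / 2, Nat.cast_div_le, ?_⟩
  rwa [max_eq_right (by omega)] at hwin
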